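/- **Setting.** Let $\boldsymbol M$ (nodes) and $\boldsymbol P$ (chains) be finite sets. Each chain $p\in\boldsymbol P$ has a frequency $n_p\in\{1,2,\dots\}$ and a phase $\theta_p\in[0,1/n_p)$; put $\mathcal D_p=\theta_p+\frac1{n_p}\mathbb Z$, let $\mu_p$ (as a measure, written $d\mu_p(k)$) be the counting measure on $\mathcal D_p$, and $\mathcal Q=\{(p,k):p\in\boldsymbol P,\ k\in\mathcal D_p\}$. On a probability space let $\pi^m$ ($m\in\boldsymbol M$) be independent Poisson random measures on $\mathbb R\times\mathbb R_+$ with Lebesgue intensity, all of whose atoms have distinct time coordinates, and let $\xi^p_k$ ($(p,k)\in\mathcal Q$) be independent real random variables (random drifts), independent of the $\pi^m$, with $\xi^p_k\sim\xi^p_{k+n}$ for $n\in\mathbb Z$. Let $\mathcal F_t$ be generated by the $\pi^m$ on $(-\infty,t]\times\mathbb R_+$ and the $\xi^p_k$ with $k\le t$. Parameters $\mathfrak M$ consist of base rates $\mu_m$, measurable interaction functions $h^\alpha_\beta:(0,\infty)\to\mathbb R$, Lipschitz link functions $\Phi^\alpha$ (nondecreasing if $\alpha\in\boldsymbol M$,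 with $\Phi^\alpha(0)=0$ if $\alpha\in\boldsymbol P$) and Lipschitz masks $\kappa^\alpha_p$, for $\alpha,\beta\in\boldsymbol M\cup\boldsymbol P$, $p\in\boldsymbol P$. They are *linear* ($\mathfrak M\in\mathfrak L$) if every $\Phi^\alpha$ is the identity (for a node, the positive part $x\mapsto\max(x,0)$ is also allowed), $\kappa^\alpha_p(x)=a^\alpha_px+b^\alpha_p$ with $a^\alpha_p,b^\alpha_p\ge0$, $h^\alpha_\beta\ge0$ and $\mu_m\ge0$. For $t_0\in\{-\infty\}\cup\mathbb R$, a HAR process with parameters $\mathfrak M$ started at $t_0$ with empty initial condition is an adapted triple $(\lambda,S,W)$ with $\lambda$ predictable, $S^m\subset[t_0,\infty)$, such that, the integrals being convergent, $$\lambda^m_t=\Phi^m\Big(\mu_m+\sum_{m'}\int_{t_0}^{t-}h^m_{m'}(t-s)\,dS^{m'}_s+\sum_p\int_{t_0}^{t-}h^m_p(t-k)\kappa^m_p(W^p_k)\,d\mu_p(k)\Big)$$ for $\mathbb P\otimes dt$-almost every $(\omega,t)$ with $t\ge t_0$; almost surely $S^m(C)=\int_{C\times\mathbb R_+}\mathbf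 1_{x\le\lambda^m_s}\,d\pi^m(s,x)$ for all $C\subset[t_0,\infty)$; and almost surely, for all $(p,k)\in\mathcal Q$ with $k\ge t_0$, $$W^p_k=\xi^p_k+\Phi^p\Big(\sum_m\int_{t_0}^{k-}h^p_m(k-s)\,dS^m_s+\sum_{p'}\int_{t_0}^{k-}h^p_{p'}(k-k')\kappa^p_{p'}(W^{p'}_{k'})\,d\mu_{p'}(k')\Big).$$ Let $\|f\|_{1,n}^\infty=\sup_{x\in\mathbb R}\sum_{k\in\mathbb Z}|f(x+k/n)|$ ($f$ extended by $0$ to $(-\infty,0]$) and write $L_\alpha$, $a^\alpha_p$ for the Lipschitz constants of $\Phi^\alpha$, $\kappa^\alpha_p$. Let $H_{\mathfrak M}$ be the matrix indexed by $\boldsymbol M\cup\boldsymbol P$ with entries $L_\alpha\|h^\alpha_m\|_1$ (column $m\in\boldsymbol M$) and $L_\alpha a^\alpha_p\|h^\alpha_p\|_{1,n_p}^\infty$ (column $p\in\boldsymbol P$), with the convention $0\cdot\infty=\infty$, and let $H^W_W$ be its $\boldsymbol P\times\boldsymbol P$ block. Assumptions: (NoExpl) the functions $h^m_{m'},h^m_p,h^p_m$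 ($m,m'\in\boldsymbol M$, $p\in\boldsymbol P$) are in $L^1$; (Spec1) $H_{\mathfrak M}$ has finite entries and spectral radius $<1$; (Spec1.1) the same for $H^W_W$; (FiMe) $\sup_{\mathcal Q}\mathbb E|\xi^p_k|<\infty$. For $\mathfrak M\in\mathfrak L$ and $(p,k),(p',k')\in\mathcal Q$ with $k'\le k$, the recursion coefficients are defined by $C^{p,k}_{p',k}=\mathbf 1_{p=p'}$ and, for $k'<k$, $C^{p,k}_{p',k'}=\sum_{p''}\int_{k'}^{k-}a^p_{p''}h^p_{p''}(k-k'')\,C^{p'',k''}_{p',k'}\,d\mu_{p''}(k'')$. Put $$\mathbb H^b_{p,k}(t_0)=\sum_{p'}\int_{t_0}^kC^{p,k}_{p',k'}\Big[\sum_{p''}b^{p'}_{p''}\int_{t_0}^{k'-}h^{p'}_{p''}(k'-k'')\,d\mu_{p''}(k'')\Big]d\mu_{p'}(k'),$$ $$\mathbb H^\xi_{p,k}(t_0)=\sum_{p'}\int_{t_0}^kC^{p,k}_{p',k'}\,\xi^{p'}_{k'}\,d\mu_{p'}(k'),\qquad \mathbb H^m_{p,k}(t_0,t)=\sum_{p'}\int_{t_0}^kC^{p,k}_{p',k'}\mathbf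 1_{t<k'}h^{p'}_m(k'-t)\,d\mu_{p'}(k').$$ **Theorem (cluster representation for linear HAR processes).** Let $\mathfrak M\in\mathfrak L$ and suppose that almost surely $\xi^p_k\ge0$ for all $(p,k)\in\mathcal Q$. Let $(\lambda,S,W)$ be a HAR process with parameters $\mathfrak M$ started at $t_0$ with empty initial condition. If $t_0\in\mathbb R$, suppose (NoExpl) and that the process is non-exploding (almost surely each $S^m$ has finitely many points in every bounded set); if $t_0=-\infty$, suppose (Spec1), (FiMe), $\sup_{m,t}\mathbb E|\lambda^m_t|<\infty$ and $\sup_{\mathcal Q}\mathbb E|W^p_k|<\infty$. Then almost surely, for all $(p,k)\in\mathcal Q$ with $k\ge t_0$, $W^p_k\ge 0$ and $$W^p_k=\mathbb H^b_{p,k}(t_0)+\mathbb H^\xi_{p,k}(t_0)+\sum_m\int_{t_0}^{k-}\mathbb H^m_{p,k}(t_0,t)\,dS^m_t,$$ and for all $m\in\boldsymbol M$ and $\mathbb P\otimes dt$-almost every $(\omega,t)$ with $t\ge t_0$, $\lambda^m_t\ge0$ and $$\lambda^m_t=\mathcal I^m(t_0,t)+\sum_{m'}\int_{t_0}^{t-}\mathfrak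 h^m_{m'}(s,t)\,dS^{m'}_s,$$ where, for $s<t$, $$\mathfrak h^m_{m_0}(s,t)=h^m_{m_0}(t-s)+\sum_{p,p'}\int_{s+}^{t-}\int_{s+}^{k}a^m_ph^m_p(t-k)\,C^{p,k}_{p',k'}\,h^{p'}_{m_0}(k'-s)\,d\mu_{p'}(k')\,d\mu_p(k),$$ $$\mathcal I^m(t_0,t)=\mu_m+\sum_p\int_{t_0}^{t-}h^m_p(t-k)\big(a^m_p\mathbb H^b_{p,k}(t_0)+a^m_p\mathbb H^\xi_{p,k}(t_0)+b^m_p\big)\,d\mu_p(k),$$ all the series and integrals being convergent sums of nonnegative terms. The cluster functions are 1-periodic: $\mathfrak h^m_{m_0}(s+1,t+1)=\mathfrak h^m_{m_0}(s,t)$. Finally, (Spec1) implies (Spec1.1), and under (Spec1.1), for all $m,m_0\in\boldsymbol M$ and $s\in\mathbb R$, $$\int_s^\infty\mathfrak h^m_{m_0}(s,t)\,dt\le\|h^m_{m_0}\|_1+\sum_{p,p'}n_p\,a^m_p\,\|h^m_p\|_1\big[(\mathrm{Id}-H^W_W)^{-1}\big]_{p,p'}\|h^{p'}_{m_0}\|_{1,1}^\infty$$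 (in $[0,\infty]$, where on the right $0\cdot\infty=0$). -/

import Mathlib

open MeasureTheory ProbabilityTheory Set
open scoped ENNReal NNReal

namespace HAR

/-! ### Time grids of the chains -/

/-- Frequencies `n p ≥ 1` and phases `θ p ∈ [0, 1 / n p)` of the chains `p : P`. -/
structure Grid (P : Type*) where
  n : P → ℕ
  n_pos : ∀ p, 0 < n p
  θ : P → ℝ
  θ_nonneg : ∀ p, 0 ≤ θ p
  θ_lt : ∀ p, θ p < 1 / (n p : ℝ)

/-- The set `𝒬` of pairs `(p, k)` with `k ∈ 𝒟_p = θ_p + (1 / n_p) ℤ` is parametrized by `P × ℤ`: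
the index `(p, j)` stands for `(p, k)` with `k = θ_p + j / n_p`, and `time` returns `k`. A sum
`∑_p ∫ … dμ_p(k)` against the counting measures of the `𝒟_p` is a sum over `P × ℤ`. -/
noncomputable def Grid.time {P : Type*} (G : Grid P) (q : P × ℤ) : ℝ :=
  G.θ q.1 + (q.2 : ℝ) / (G.n q.1 : ℝ)

/-- Only finitely many grid times lie in a bounded window. -/
theorem Grid.finite_Ico {P : Type*} [Finite P] (G : Grid P) (a b : ℝ) :
    {r : P × ℤ | a ≤ G.time r ∧ G.time r < b}.Finite := by
  have key : ∀ p : P, {j : ℤ | a ≤ G.time (p, j) ∧ G.time (p, j) < b}.Finite := by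
    intro p
    have hn : (0 : ℝ) < G.n p := by exact_mod_cast G.n_pos p
    refine (Set.finite_Icc ⌊(a - G.θ p) * G.n p⌋ ⌈(b - G.θ p) * G.n p⌉).subset ?_
    rintro j ⟨h1, h2⟩
    simp only [Grid.time] at h1 h2
    have h1' : (a - G.θ p) * G.n p ≤ j := by
      rw [← le_div_iff₀ hn]; linarith
    have h2' : (j : ℝ) ≤ (b - G.θ p) * G.n p := by
      rw [← div_le_iff₀ hn]; linarith
    constructor
    · exact_mod_cast (Int.floor_le _).trans h1'
    · exact_mod_cast h2'.trans (Int.le_ceil _)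
  refine (Set.finite_iUnion fun p => (key p).image (Prod.mk p)).subset ?_
  rintro ⟨p, j⟩ h
  exact Set.mem_iUnion.2 ⟨p, j, h, rfl⟩

/-! ### Parameters -/

/-- The (smallest) Lipschitz constant of a Lipschitz function. -/
noncomputable def lip (f : ℝ → ℝ) : ℝ≥0 := sInf {K : ℝ≥0 | LipschitzWith K f}

/-- Parameters of a HAR process with set of nodes `N` and set of chains `P`; an element of
`N ⊕ P` is a node or a chain. `h α β` is a function on `(0, ∞)`: only its values at positive
arguments are ever used. Nonnegativity of the link functions of the nodes is not imposed, so
that linear parameters may have the identity as link function. -/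
structure Params (N P : Type*) where
  μ : N → ℝ
  h : N ⊕ P → N ⊕ P → ℝ → ℝ
  Φ : N ⊕ P → ℝ → ℝ
  κ : N ⊕ P → P → ℝ → ℝ
  measurable_h : ∀ α β, Measurable (h α β)
  lipschitz_Φ : ∀ α, ∃ K : ℝ≥0, LipschitzWith K (Φ α)
  lipschitz_κ : ∀ α p, ∃ K : ℝ≥0, LipschitzWith K (κ α p)
  monotone_Φ : ∀ m, Monotone (Φ (Sum.inl m))
  Φ_zero : ∀ p, Φ (Sum.inr p) 0 = 0

/-- `‖f‖₁` for a function on `(0, ∞)`. -/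
noncomputable def normL1 (f : ℝ → ℝ) : ℝ≥0∞ := ∫⁻ x in Ioi (0 : ℝ), ‖f x‖ₑ

open Classical in
/-- `‖f‖_{1,n}^∞ = sup_x ∑_{k ∈ ℤ} |f (x + k / n)|` for a function on `(0, ∞)`, extended by `0`. -/
noncomputable def normLattice (f : ℝ → ℝ) (n : ℕ) : ℝ≥0∞ :=
  ⨆ x : ℝ, ∑' k : ℤ, if 0 < x + (k : ℝ) / (n : ℝ) then ‖f (x + (k : ℝ) / (n : ℝ))‖ₑ else 0

namespace Params

variable {N P : Type*}

/-- `a^α_p`, the Lipschitz constant of the mask `κ^α_p`. -/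
noncomputable def a (M : Params N P) (α : N ⊕ P) (p : P) : ℝ := (lip (M.κ α p) : ℝ)

/-- `b^α_p`, the value of the mask `κ^α_p` at `0`. -/
def b (M : Params N P) (α : N ⊕ P) (p : P) : ℝ := M.κ α p 0

/-- The norm of `h^α_β` that enters the interaction matrix: `‖·‖₁` if `β` is a node and
`‖·‖_{1,n_β}^∞` if `β` is a chain. -/
noncomputable def hNorm (M : Params N P) (G : Grid P) (α : N ⊕ P) : N ⊕ P → ℝ≥0∞
  | Sum.inl m => normL1 (M.h α (Sum.inl m))
  | Sum.inr p => normLattice (M.h α (Sum.inr p)) (G.n p)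

/-- The interaction matrix `H_𝔐`, of use only when all the norms `hNorm` are finite. -/
noncomputable def H (M : Params N P) (G : Grid P) : Matrix (N ⊕ P) (N ⊕ P) ℝ := fun α β =>
  match β with
  | Sum.inl m => (lip (M.Φ α) : ℝ) * (M.hNorm G α (Sum.inl m)).toReal
  | Sum.inr p => (lip (M.Φ α) : ℝ) * M.a α p * (M.hNorm G α (Sum.inr p)).toReal

/-- The block `H^W_W` of the interaction matrix. -/
noncomputable def HWW (M : Params N P) (G : Grid P) : Matrix P P ℝ := (M.H G).toBlocks₂₂

/-- Assumption (NoExpl). -/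
def NoExpl (M : Params N P) : Prop :=
  (∀ m, ∃ K : ℝ≥0, LipschitzWith K (M.Φ (Sum.inl m))) ∧
  (∀ m m' : N, normL1 (M.h (Sum.inl m) (Sum.inl m')) ≠ ∞) ∧
  (∀ (m : N) (p : P), normL1 (M.h (Sum.inl m) (Sum.inr p)) ≠ ∞) ∧
  (∀ (p : P) (m : N), normL1 (M.h (Sum.inr p) (Sum.inl m)) ≠ ∞)

/-- Assumption (Spec1): `spr H_𝔐 < 1`. By the convention `0 × ∞ = ∞` for the entries of `H_𝔐`, the
norms of all the interaction functions are finite. -/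
def Spec1 [Fintype N] [Fintype P] [DecidableEq N] [DecidableEq P]
    (M : Params N P) (G : Grid P) : Prop :=
  (∀ α β, M.hNorm G α β ≠ ∞) ∧
    spectralRadius ℂ ((M.H G).map (fun x : ℝ => (x : ℂ))) < 1

/-- Assumption (Spec1.1): `spr H^W_W < 1`, with the same convention on infinite entries. -/
def Spec11 [Fintype P] [DecidableEq P] (M : Params N P) (G : Grid P) : Prop :=
  (∀ p p' : P, M.hNorm G (Sum.inr p) (Sum.inr p') ≠ ∞) ∧
    spectralRadius ℂ ((M.HWW G).map (fun x : ℝ => (x : ℂ))) < 1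

/-- The class `𝔏` of linear parameters. The link function of a node is the identity or, for the
reader who wants link functions of nodes to be nonnegative, its positive part. -/
structure IsLinear (M : Params N P) : Prop where
  link_node : ∀ m, M.Φ (Sum.inl m) = id ∨ M.Φ (Sum.inl m) = fun x => max x 0
  link_chain : ∀ p, M.Φ (Sum.inr p) = id
  mask : ∀ α p, ∃ a b : ℝ, 0 ≤ a ∧ 0 ≤ b ∧ ∀ x, M.κ α p x = a * x + b
  h_nonneg : ∀ α β x, 0 < x → 0 ≤ M.h α β x
  μ_nonneg : ∀ m, 0 ≤ M.μ m

end Params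

/-! ### Driving randomness -/

section Randomness

variable {Ω N P : Type*}

/-- The σ-algebra `σ(T ∩ A)` generated by the restriction to `A` of a random set of points `T`:
it is generated by the numbers of points in the Borel subsets of `A`. -/
@[reducible] noncomputable def sigmaPoints {E : Type*} [MeasurableSpace E] (T : Ω → Set E) (A : Set E) : MeasurableSpace Ω :=
  ⨆ B : {B : Set E // MeasurableSet B ∧ B ⊆ A},
    MeasurableSpace.comap (fun ω => (T ω ∩ B.1).encard) inferInstance

/-- Lebesgue measure on `ℝ × [0, ∞)`. -/
noncomputable def lebUpper : Measure (ℝ × ℝ) := volume.restrict (univ ×ˢ Ici 0)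

/-- `T`, a random set of points (the atoms), is a Poisson random measure on `ℝ × [0, ∞)` with
Lebesgue intensity. -/
structure IsPoissonRandomMeasure [MeasurableSpace Ω] (Pr : Measure Ω) (T : Ω → Set (ℝ × ℝ)) :
    Prop where
  subset : ∀ ω, T ω ⊆ univ ×ˢ Ici 0
  measurable : ∀ B, MeasurableSet B → Measurable fun ω => (T ω ∩ B).encard
  law : ∀ B, MeasurableSet B → lebUpper B ≠ ∞ → ∀ j : ℕ,
    Pr {ω | (T ω ∩ B).encard = j} = poissonMeasure (lebUpper B).toNNReal {j}
  indep : ∀ (l : ℕ) (B : Fin l → Set (ℝ × ℝ)), (∀ i, MeasurableSet (B i)) →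
    Pairwise (fun i j => Disjoint (B i) (B j)) → iIndepFun (fun i ω => (T ω ∩ B i).encard) Pr

/-- The driving randomness: independent Poisson random measures `π^m`, all of whose atoms have
distinct time coordinates, and independent random drifts `ξ^p_k`, independent of the `π^m`, whose
laws are 1-periodic in `k`. -/
structure IsDriving [MeasurableSpace Ω] (Pr : Measure Ω) (G : Grid P) (π : N → Ω → Set (ℝ × ℝ))
    (ξ : P × ℤ → Ω → ℝ) : Prop where
  poisson : ∀ m, IsPoissonRandomMeasure Pr (π m)
  measurable_ξ : ∀ q, Measurable (ξ q)
  indep : iIndep (Sum.elim (fun m : N => sigmaPoints (π m) univ)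
    (fun q : P × ℤ => MeasurableSpace.comap (ξ q) inferInstance)) Pr
  identDistrib : ∀ q q' : P × ℤ, q.1 = q'.1 → (∃ l : ℤ, G.time q' = G.time q + l) →
    IdentDistrib (ξ q) (ξ q') Pr Pr
  distinct_times : ∀ ω m m' s x x', (s, x) ∈ π m ω → (s, x') ∈ π m' ω → m = m' ∧ x = x'

/-- The σ-algebra `ℱ_t`. -/
@[reducible] noncomputable def history (G : Grid P) (π : N → Ω → Set (ℝ × ℝ)) (ξ : P × ℤ → Ω → ℝ) (t : ℝ) :
    MeasurableSpace Ω :=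
  (⨆ m : N, sigmaPoints (π m) (Iic t ×ˢ Ici 0)) ⊔
    ⨆ q : {q : P × ℤ // G.time q ≤ t}, MeasurableSpace.comap (ξ q.1) inferInstance

/-- The predictable σ-algebra on `Ω × ℝ` of a filtration indexed by `ℝ`, generated by the sets
`A × (s, t]` with `A ∈ ℱ_s`. -/
@[reducible] def predictableSigma (ℱ : ℝ → MeasurableSpace Ω) : MeasurableSpace (Ω × ℝ) :=
  MeasurableSpace.generateFrom
    {D | ∃ (s t : ℝ) (A : Set Ω), s < t ∧ MeasurableSet[ℱ s] A ∧ D = A ×ˢ Ioc s t}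

/-- Assumption (FiMe). -/
def FiMe [MeasurableSpace Ω] (Pr : Measure Ω) (ξ : P × ℤ → Ω → ℝ) : Prop :=
  ⨆ q, ∫⁻ ω, ‖ξ q ω‖ₑ ∂Pr < ∞

end Randomness

/-! ### HAR processes -/

/-- Points of `S` in `[t₀, t)`. The starting time `t₀` is real, or `⊥`, which stands for `-∞`. -/
def past (t₀ : WithBot ℝ) (t : ℝ) (S : Set ℝ) : Set ℝ := {s | s ∈ S ∧ t₀ ≤ (s : WithBot ℝ) ∧ s < t}

/-- The elements `(p, k)` of `𝒬` with `k ∈ [t₀, t)`. -/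
def Grid.past {P : Type*} (G : Grid P) (t₀ : WithBot ℝ) (t : ℝ) : Set (P × ℤ) :=
  {q | t₀ ≤ (G.time q : WithBot ℝ) ∧ G.time q < t}

/-- The elements `(p, k)` of `𝒬` with `k ∈ [t₀, t]`. -/
def Grid.pastClosed {P : Type*} (G : Grid P) (t₀ : WithBot ℝ) (t : ℝ) : Set (P × ℤ) :=
  {q | t₀ ≤ (G.time q : WithBot ℝ) ∧ G.time q ≤ t}

section Triples

variable {Ω N P : Type*}

/-- A candidate process: intensities `lam`, point sets `S` and chains `W`. -/
structure Triple (Ω N P : Type*) where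
  lam : N → ℝ → Ω → ℝ
  S : N → Ω → Set ℝ
  W : P × ℤ → Ω → ℝ

/-- The argument of the link function of `α` at time `t` (without the base rate): the sum of
`∫_{[t₀,t)} h^α_m (t - s) dS^m_s` over the nodes and of
`∫_{[t₀,t)} h^α_p (t - k) κ^α_p (W^p_k) dμ_p(k)` over the chains. -/
noncomputable def Triple.input [Fintype N] (X : Triple Ω N P) (G : Grid P) (M : Params N P)
    (t₀ : WithBot ℝ) (α : N ⊕ P) (t : ℝ) (ω : Ω) : ℝ :=
  (∑ m, ∑' s : past t₀ t (X.S m ω), M.h α (Sum.inl m) (t - s)) +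
    ∑' q : G.past t₀ t, M.h α (Sum.inr q.1.1) (t - G.time q) * M.κ α q.1.1 (X.W q ω)

/-- The integrals in `Triple.input` converge. -/
def Triple.InputConverges (X : Triple Ω N P) (G : Grid P) (M : Params N P)
    (t₀ : WithBot ℝ) (α : N ⊕ P) (t : ℝ) (ω : Ω) : Prop :=
  (∀ m, Summable fun s : past t₀ t (X.S m ω) => M.h α (Sum.inl m) (t - s)) ∧
    Summable fun q : G.past t₀ t =>
      M.h α (Sum.inr q.1.1) (t - G.time q) * M.κ α q.1.1 (X.W q ω)

/-- `X` is a HAR process with parameters `M` started at `t₀ ∈ {-∞} ∪ ℝ` with empty initial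
condition: no point before `t₀`, and the values of the chains before `t₀` play no role. That one of
the equations holds includes that the integrals in it converge. -/
structure IsHAR [MeasurableSpace Ω] [Fintype N] (Pr : Measure Ω) (G : Grid P)
    (π : N → Ω → Set (ℝ × ℝ)) (ξ : P × ℤ → Ω → ℝ) (M : Params N P) (t₀ : WithBot ℝ)
    (X : Triple Ω N P) : Prop where
  predictable : ∀ m,
    Measurable[predictableSigma (history G π ξ)] fun z : Ω × ℝ => X.lam m z.2 z.1
  adapted_S : ∀ m t, sigmaPoints (X.S m) (Iic t) ≤ history G π ξ t
  adapted_W : ∀ q, t₀ ≤ (G.time q : WithBot ℝ) → Measurable[history G π ξ (G.time q)] (X.W q)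
  init : ∀ᵐ ω ∂Pr, ∀ m, ∀ s ∈ X.S m ω, t₀ ≤ (s : WithBot ℝ)
  eq_lam : ∀ᵐ z ∂(Pr.prod (volume.restrict {t : ℝ | t₀ ≤ (t : WithBot ℝ)})), ∀ m,
    X.InputConverges G M t₀ (Sum.inl m) z.2 z.1 ∧
    X.lam m z.2 z.1 = M.Φ (Sum.inl m) (M.μ m + X.input G M t₀ (Sum.inl m) z.2 z.1)
  eq_S : ∀ᵐ ω ∂Pr, ∀ m, ∀ C ⊆ {t : ℝ | t₀ ≤ (t : WithBot ℝ)},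
    (X.S m ω ∩ C).encard = {z | z ∈ π m ω ∧ z.1 ∈ C ∧ z.2 ≤ X.lam m z.1 ω}.encard
  eq_W : ∀ᵐ ω ∂Pr, ∀ q : P × ℤ, t₀ ≤ (G.time q : WithBot ℝ) →
    X.InputConverges G M t₀ (Sum.inr q.1) (G.time q) ω ∧
    X.W q ω = ξ q ω + M.Φ (Sum.inr q.1) (X.input G M t₀ (Sum.inr q.1) (G.time q) ω)

/-- Almost surely, finitely many points in every bounded set (the intensities and the chains are
real valued). -/
def Triple.NonExploding [MeasurableSpace Ω] (X : Triple Ω N P) (Pr : Measure Ω) : Prop :=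
  ∀ᵐ ω ∂Pr, ∀ m, ∀ C : Set ℝ, Bornology.IsBounded C → (X.S m ω ∩ C).Finite

/-- The intensities and the chains are bounded in `L¹`. -/
def Triple.BoundedL1 [MeasurableSpace Ω] (X : Triple Ω N P) (Pr : Measure Ω) : Prop :=
  (⨆ m, ⨆ t, ∫⁻ ω, ‖X.lam m t ω‖ₑ ∂Pr < ∞) ∧ ⨆ q, ∫⁻ ω, ‖X.W q ω‖ₑ ∂Pr < ∞

end Triples

/-! ### Recursion coefficients, cluster functions and immigrant rates -/

section Cluster

variable {N P : Type*} [Fintype P]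

open Classical in
/-- The coefficient `C^{p,k}_{p',k'}`, with `q = (p, k)` and `q' = (p', k')`: it is
`1_{p = p'}` if `k = k'`, it solves
`C^{p,k}_{p',k'} = ∑_{p''} ∫_{[k',k)} a^p_{p''} h^p_{p''} (k - k'') C^{p'',k''}_{p',k'} dμ_{p''}(k'')`
if `k' < k`, and it is set to `0` (and not used) if `k < k'`. -/
noncomputable def coef (G : Grid P) (M : Params N P) (q q' : P × ℤ) : ℝ :=
  if q = q' then 1
  else if G.time q' < G.time q then
    ∑ r ∈ (G.finite_Ico (G.time q') (G.time q)).toFinset.attach,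
      M.a (Sum.inr q.1) r.1.1 * M.h (Sum.inr q.1) (Sum.inr r.1.1) (G.time q - G.time r.1) *
        coef G M r.1 q'
  else 0
termination_by (G.finite_Ico (G.time q') (G.time q)).toFinset.card
decreasing_by
  have hr := (Set.Finite.mem_toFinset _).1 r.2
  apply Finset.card_lt_card
  rw [Finset.ssubset_iff_of_subset]
  · exact ⟨r.1, r.2, fun h => lt_irrefl _ ((Set.Finite.mem_toFinset _).1 h).2⟩
  · intro x hx
    have hx' := (Set.Finite.mem_toFinset _).1 hx
    exact (Set.Finite.mem_toFinset _).2 ⟨hx'.1, hx'.2.trans hr.2⟩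

/-- `ℍ^b_{p,k}(t₀)`. Its terms are nonnegative for linear parameters, and so are those of the
quantities below: all of them take values in `[0, ∞]`. -/
noncomputable def Hb (G : Grid P) (M : Params N P) (t₀ : WithBot ℝ) (q : P × ℤ) : ℝ≥0∞ :=
  ∑' q' : G.pastClosed t₀ (G.time q), ENNReal.ofReal (coef G M q q') *
    ∑' q'' : G.past t₀ (G.time q'),
      ENNReal.ofReal (M.b (Sum.inr q'.1.1) q''.1.1 *
        M.h (Sum.inr q'.1.1) (Sum.inr q''.1.1) (G.time q' - G.time q''))

/-- `ℍ^ξ_{p,k}(t₀)`, for a realization `x` of the random drifts. -/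
noncomputable def Hxi (G : Grid P) (M : Params N P) (t₀ : WithBot ℝ) (x : P × ℤ → ℝ)
    (q : P × ℤ) : ℝ≥0∞ :=
  ∑' q' : G.pastClosed t₀ (G.time q), ENNReal.ofReal (coef G M q q') * ENNReal.ofReal (x q')

open Classical in
/-- `ℍ^m_{p,k}(t₀, t)`. -/
noncomputable def Hpt (G : Grid P) (M : Params N P) (t₀ : WithBot ℝ) (m : N) (q : P × ℤ)
    (t : ℝ) : ℝ≥0∞ :=
  ∑' q' : G.pastClosed t₀ (G.time q), ENNReal.ofReal (coef G M q q') *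
    if t < G.time q' then
      ENNReal.ofReal (M.h (Sum.inr q'.1.1) (Sum.inl m) (G.time q' - t))
    else 0

/-- The cluster function `𝔥^m_{m₀}(s, t)`, for `s < t`: `q = (p, k)` runs over `s < k < t` and
`q' = (p', k')` over `s < k' ≤ k`. -/
noncomputable def clusterFun (G : Grid P) (M : Params N P) (m m₀ : N) (s t : ℝ) : ℝ≥0∞ :=
  ENNReal.ofReal (M.h (Sum.inl m) (Sum.inl m₀) (t - s)) +
    ∑' q : {q : P × ℤ // s < G.time q ∧ G.time q < t},
      ∑' q' : {q' : P × ℤ // s < G.time q' ∧ G.time q' ≤ G.time q},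
        ENNReal.ofReal (M.a (Sum.inl m) q.1.1 *
          M.h (Sum.inl m) (Sum.inr q.1.1) (t - G.time q)) *
        ENNReal.ofReal (coef G M q q') *
        ENNReal.ofReal (M.h (Sum.inr q'.1.1) (Sum.inl m₀) (G.time q' - s))

/-- The immigrant rate `ℐ^m(t₀, t)`, for a realization `x` of the random drifts. -/
noncomputable def immigrantRate (G : Grid P) (M : Params N P) (t₀ : WithBot ℝ)
    (x : P × ℤ → ℝ) (m : N) (t : ℝ) : ℝ≥0∞ :=
  ENNReal.ofReal (M.μ m) +
    ∑' q : G.past t₀ t,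
      ENNReal.ofReal (M.h (Sum.inl m) (Sum.inr q.1.1) (t - G.time q)) *
        (ENNReal.ofReal (M.a (Sum.inl m) q.1.1) * Hb G M t₀ q +
          ENNReal.ofReal (M.a (Sum.inl m) q.1.1) * Hxi G M t₀ x q +
          ENNReal.ofReal (M.b (Sum.inl m) q.1.1))

end Cluster

end HAR

/-! Extended by `0` before `t₀`, the chains solve a linear equation `w = g + K w`. Here `K`
(`kernelOp`) has the weights `a h` and only looks strictly into the past, and the source `g`
collects the drifts, the `b`-terms and the influence of the points. The coefficients `C` are the
fundamental solution, `C(·, q') = δ_{q'} + K C(·, q')`, so `green g = ∑ C g` is a solution too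
(`green_eq`), and in fact the smallest one in `[0, ∞]` (`green_le`). The excess `d = w - green g`
satisfies `d ≤ K d` and `d ≤ w`, so the representation of the chains is a uniqueness statement: no
nonzero subinvariant `d` lies below `|W|` (`eq_green`).

For real `t₀` uniqueness is induction along the grid, because `d` vanishes before `t₀`
(`eq_zero_of_le_kernelOp`). For `t₀ = -∞`, iteration gives `d ≤ Kⁿ |W|`, whose expectation is at
most a constant times a row sum of the `n`-th power of `H^W_W`; this tends to `0` when the spectral
radius is less than `1` (`ae_eq_zero_of_le_kernelOp`). The same uniqueness yields positivity, since
the negative part of `W` is itself subinvariant (`Triple.NoSubinvariant.chain_nonneg`). Once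
everything is nonnegative the computation takes place in `[0, ∞]`, where sums may be exchanged
freely. Substituting the chains into the intensity and collecting the contributions of each point
produces the cluster functions (`tsum_past_clusterFun`, `Triple.lam_eq_of_chain`).

Periodicity holds because `C` depends on times only through their differences and integer
translations preserve the grid (`coef_shift`). For the integral bound, the resolvent `(1 - H^W_W)⁻¹`
is a supersolution, so the comparison principle bounds the row sums of `C` (`tsum_coef_le`). The sum
over the periods of the receiving chain is moved by translation onto the interaction function, where
it becomes a lattice norm (`tsum_tsum_coef_mul_le`). -/

namespace HAR

/-! ### Spectral radius of nonnegative matrices -/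

section Spectral

open Filter Topology

attribute [local instance] Matrix.linftyOpNormedRing Matrix.linftyOpNormedAlgebra

variable {ι κ : Type*} [Fintype ι] [DecidableEq ι] [Fintype κ] [DecidableEq κ]

theorem map_ofReal_pow (A : Matrix ι ι ℝ) (n : ℕ) :
    (A.map (fun x : ℝ => (x : ℂ))) ^ n = (A ^ n).map (fun x : ℝ => (x : ℂ)) :=
  (map_pow (Complex.ofRealHom.mapMatrix (m := ι)) A n).symm

theorem nnnorm_apply_le_linfty_opNNNorm (A : Matrix ι ι ℂ) (i j : ι) : ‖A i j‖₊ ≤ ‖A‖₊ := by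
  rw [Matrix.linfty_opNNNorm_def]
  refine le_trans ?_ (Finset.le_sup (f := fun i => ∑ j, ‖A i j‖₊) (Finset.mem_univ i))
  exact Finset.single_le_sum (f := fun j => ‖A i j‖₊) (fun _ _ => zero_le) (Finset.mem_univ j)

/-- The powers of a matrix with spectral radius less than `1` tend to `0`. -/
theorem tendsto_pow_apply_of_spectralRadius_lt_one (A : Matrix ι ι ℝ)
    (h : spectralRadius ℂ (A.map (fun x : ℝ => (x : ℂ))) < 1) (i j : ι) :
    Tendsto (fun n : ℕ => (A ^ n) i j) atTop (𝓝 0) := by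
  obtain ⟨r, hr, hr1⟩ := ENNReal.lt_iff_exists_nnreal_btwn.1 h
  have hr1' : r < 1 := by exact_mod_cast hr1
  -- Gelfand's formula: `‖Aⁿ‖^(1/n)` tends to the spectral radius, which is below `r < 1`, so
  -- eventually `‖Aⁿ‖ ≤ rⁿ`.
  have hG := spectrum.pow_nnnorm_pow_one_div_tendsto_nhds_spectralRadius
    (A.map (fun x : ℝ => (x : ℂ)))
  have hev : ∀ᶠ n : ℕ in atTop, ‖(A ^ n) i j‖ ≤ (r : ℝ) ^ n := by
    filter_upwards [hG.eventually (gt_mem_nhds hr), eventually_gt_atTop 0] with n hn hn0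
    have h1 : ((‖A.map (fun x : ℝ => (x : ℂ)) ^ n‖₊ : ℝ≥0∞)) ≤ (r : ℝ≥0∞) ^ n := by
      have h2 := ENNReal.rpow_le_rpow hn.le (Nat.cast_nonneg (α := ℝ) n)
      rw [← ENNReal.rpow_mul, one_div, inv_mul_cancel₀ (by positivity), ENNReal.rpow_one,
        ENNReal.rpow_natCast] at h2
      exact h2
    have h3 : ‖A.map (fun x : ℝ => (x : ℂ)) ^ n‖₊ ≤ r ^ n := by exact_mod_cast h1
    have h4 := (nnnorm_apply_le_linfty_opNNNorm _ i j).trans h3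
    rw [map_ofReal_pow, Matrix.map_apply] at h4
    have h5 : ‖(((A ^ n) i j : ℝ) : ℂ)‖ ≤ (r : ℝ) ^ n := by exact_mod_cast h4
    rwa [Complex.norm_real] at h5
  exact squeeze_zero_norm' hev
    (tendsto_pow_atTop_nhds_zero_of_lt_one r.coe_nonneg (by exact_mod_cast hr1'))

/-- The number `1` exceeds the spectral radius, hence lies in the resolvent set of the complexified
matrix; the complex determinant is the image of the real one. -/
theorem isUnit_one_sub_of_spectralRadius_lt_one (A : Matrix ι ι ℝ)
    (h : spectralRadius ℂ (A.map (fun x : ℝ => (x : ℂ))) < 1) : IsUnit (1 - A).det := by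
  have h1 := spectrum.mem_resolventSet_of_spectralRadius_lt (k := (1 : ℂ)) (by simpa using h)
  rw [spectrum.mem_resolventSet_iff, map_one, Matrix.isUnit_iff_isUnit_det] at h1
  have h2 : (1 - A.map (fun x : ℝ => (x : ℂ))) = Complex.ofRealHom.mapMatrix (1 - A) := by
    rw [map_sub, map_one]; rfl
  rw [h2, ← RingHom.map_det, isUnit_iff_ne_zero] at h1
  exact isUnit_iff_ne_zero.2 fun h0 => h1 (by rw [h0, map_zero])

/-- The resolvent `B = (1 - A)⁻¹` of a matrix with spectral radius less than `1` solves
`B = 1 + A * B`. -/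
theorem inv_one_sub_eq_one_add_mul (A : Matrix ι ι ℝ)
    (h : spectralRadius ℂ (A.map (fun x : ℝ => (x : ℂ))) < 1) :
    (1 - A)⁻¹ = 1 + A * (1 - A)⁻¹ := by
  have h1 := Matrix.mul_nonsing_inv _ (isUnit_one_sub_of_spectralRadius_lt_one A h)
  rw [sub_mul, one_mul] at h1
  exact sub_eq_iff_eq_add.1 h1

theorem pow_apply_nonneg {A : Matrix ι ι ℝ} (hA : ∀ i j, 0 ≤ A i j) (n : ℕ) (i j : ι) :
    0 ≤ (A ^ n) i j := by
  induction n generalizing i j with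
  | zero => rw [pow_zero, Matrix.one_apply]; split_ifs <;> norm_num
  | succ n ih =>
    rw [pow_succ, Matrix.mul_apply]
    exact Finset.sum_nonneg fun k _ => mul_nonneg (ih i k) (hA k j)

/-- With `B = (1 - A)⁻¹`, the identity `B = 1 + A B` gives `Aⁿ B = Aⁿ + Aⁿ⁺¹ B`. So the entries of
`Aⁿ B` decrease in `n` and stay below those of `B`, while they tend to `0`. -/
theorem inv_one_sub_apply_nonneg {A : Matrix ι ι ℝ} (hA : ∀ i j, 0 ≤ A i j)
    (h : spectralRadius ℂ (A.map (fun x : ℝ => (x : ℂ))) < 1) (i j : ι) :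
    0 ≤ ((1 - A)⁻¹ : Matrix ι ι ℝ) i j := by
  have key : ∀ n : ℕ, (A ^ n * (1 - A)⁻¹) i j ≤ ((1 - A)⁻¹ : Matrix ι ι ℝ) i j := by
    intro n
    induction n with
    | zero => simp
    | succ n ih =>
      refine le_trans ?_ ih
      conv_rhs => rw [inv_one_sub_eq_one_add_mul A h, mul_add, mul_one, ← mul_assoc, ← pow_succ]
      rw [Matrix.add_apply]
      linarith [pow_apply_nonneg hA n i j]
  refine le_of_tendsto' (x := atTop) (f := fun n : ℕ => (A ^ n * (1 - A)⁻¹) i j) ?_ key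
  simp only [Matrix.mul_apply]
  rw [show (0 : ℝ) = ∑ k, 0 * ((1 - A)⁻¹ : Matrix ι ι ℝ) k j by simp]
  exact tendsto_finsetSum _ fun k _ =>
    (tendsto_pow_apply_of_spectralRadius_lt_one A h i k).mul_const _

/-- An entry of a power is a sum of weights of paths, and the paths that stay in the block are some
of all paths. -/
theorem toBlocks₂₂_pow_apply_le {A : Matrix (κ ⊕ ι) (κ ⊕ ι) ℝ} (hA : ∀ i j, 0 ≤ A i j)
    (n : ℕ) (i j : ι) : (A.toBlocks₂₂ ^ n) i j ≤ (A ^ n) (Sum.inr i) (Sum.inr j) := by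
  induction n generalizing i j with
  | zero => simp [Matrix.one_apply]
  | succ n ih =>
    rw [pow_succ, pow_succ, Matrix.mul_apply, Matrix.mul_apply, Fintype.sum_sum_type]
    refine le_add_of_nonneg_of_le
      (Finset.sum_nonneg fun k _ => mul_nonneg (pow_apply_nonneg hA _ _ _) (hA _ _)) ?_
    exact Finset.sum_le_sum fun k _ => mul_le_mul_of_nonneg_right (ih i k) (hA _ _)

/-- The spectral radius of a principal block of a nonnegative matrix is at most that of the
matrix. -/
theorem spectralRadius_toBlocks₂₂_le {A : Matrix (κ ⊕ ι) (κ ⊕ ι) ℝ} (hA : ∀ i j, 0 ≤ A i j) :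
    spectralRadius ℂ (A.toBlocks₂₂.map (fun x : ℝ => (x : ℂ))) ≤
      spectralRadius ℂ (A.map (fun x : ℝ => (x : ℂ))) := by
  -- By Gelfand's formula it suffices to compare the norms of the powers. These are maximal row sums
  -- of absolute values, so the entrywise comparison is enough.
  refine le_of_tendsto_of_tendsto'
    (spectrum.pow_nnnorm_pow_one_div_tendsto_nhds_spectralRadius _)
    (spectrum.pow_nnnorm_pow_one_div_tendsto_nhds_spectralRadius _) fun n => ?_
  refine ENNReal.rpow_le_rpow ?_ (by positivity)
  rw [map_ofReal_pow, map_ofReal_pow, ENNReal.coe_le_coe, Matrix.linfty_opNNNorm_def,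
    Matrix.linfty_opNNNorm_def]
  refine Finset.sup_le fun i _ => ?_
  refine le_trans ?_ (Finset.le_sup (f := fun i : κ ⊕ ι =>
    ∑ j, ‖(A ^ n).map (fun x : ℝ => (x : ℂ)) i j‖₊) (Finset.mem_univ (Sum.inr i)))
  rw [Fintype.sum_sum_type]
  refine le_add_of_nonneg_of_le zero_le (Finset.sum_le_sum fun j _ => ?_)
  rw [← NNReal.coe_le_coe, coe_nnnorm, coe_nnnorm, Matrix.map_apply, Matrix.map_apply,
    Complex.norm_real, Complex.norm_real, Real.norm_of_nonneg (pow_apply_nonneg hA _ _ _),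
    Real.norm_of_nonneg (pow_apply_nonneg (A := A.toBlocks₂₂) (fun _ _ => hA _ _) n i j)]
  exact toBlocks₂₂_pow_apply_le hA n i j

end Spectral

/-! ### Linear parameters -/

/-- Evaluation at `1` and `0` shows that no smaller constant works. This identifies `Params.a`,
defined as a Lipschitz constant, with the slope of an affine mask. -/
theorem lip_eq_of_forall {f : ℝ → ℝ} {a b : ℝ} (ha : 0 ≤ a)
    (hf : ∀ x, f x = a * x + b) : (lip f : ℝ) = a := by
  have hL : LipschitzWith ⟨a, ha⟩ f := LipschitzWith.of_dist_le_mul fun x y => by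
    rw [hf, hf, Real.dist_eq, Real.dist_eq, add_sub_add_right_eq_sub, ← mul_sub, abs_mul,
      abs_of_nonneg ha]
    exact le_rfl
  have h1 : lip f = ⟨a, ha⟩ := by
    refine IsLeast.csInf_eq ⟨hL, fun K hK => ?_⟩
    have h := (show LipschitzWith K f from hK).dist_le_mul 1 0
    rw [hf, hf, Real.dist_eq, Real.dist_eq] at h
    simp only [mul_one, mul_zero, zero_add, add_sub_cancel_right, sub_zero, abs_one] at h
    exact (le_abs_self a).trans h
  rw [h1]; rfl

namespace Params

variable {N P : Type*} {M : Params N P}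

theorem a_nonneg (M : Params N P) (α : N ⊕ P) (p : P) : 0 ≤ M.a α p := NNReal.coe_nonneg _

theorem IsLinear.mask_eq (hM : M.IsLinear) (α : N ⊕ P) (p : P) (x : ℝ) :
    M.κ α p x = M.a α p * x + M.b α p := by
  obtain ⟨a, b, ha, -, h⟩ := hM.mask α p
  rw [Params.a, lip_eq_of_forall ha h, Params.b, h, h]; simp

theorem IsLinear.b_nonneg (hM : M.IsLinear) (α : N ⊕ P) (p : P) : 0 ≤ M.b α p := by
  obtain ⟨a, b, -, hb, h⟩ := hM.mask α p
  rw [Params.b, h]; simpa using hb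

theorem IsLinear.lip_link_chain (hM : M.IsLinear) (p : P) :
    (lip (M.Φ (Sum.inr p)) : ℝ) = 1 :=
  lip_eq_of_forall zero_le_one (b := 0) fun x => by rw [hM.link_chain]; simp

theorem H_nonneg (M : Params N P) (G : Grid P) (α β : N ⊕ P) : 0 ≤ M.H G α β := by
  unfold H
  cases β with
  | inl m => exact mul_nonneg (NNReal.coe_nonneg _) ENNReal.toReal_nonneg
  | inr p =>
    exact mul_nonneg (mul_nonneg (NNReal.coe_nonneg _) (M.a_nonneg _ _)) ENNReal.toReal_nonneg

theorem HWW_nonneg (M : Params N P) (G : Grid P) (p p' : P) : 0 ≤ M.HWW G p p' :=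
  M.H_nonneg G (Sum.inr p) (Sum.inr p')

theorem Spec1.spec11 [Fintype N] [Fintype P] [DecidableEq N] [DecidableEq P] {G : Grid P}
    (h : M.Spec1 G) : M.Spec11 G :=
  ⟨fun _ _ => h.1 _ _, (spectralRadius_toBlocks₂₂_le (M.H_nonneg G)).trans_lt h.2⟩

/-- The link function of a chain is the identity, with Lipschitz constant `1`. Finiteness of the
norm is needed because `toReal` sends `∞` to `0`. -/
theorem IsLinear.ofReal_HWW (hM : M.IsLinear) {G : Grid P} {p p' : P}
    (h : M.hNorm G (Sum.inr p) (Sum.inr p') ≠ ∞) :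
    ENNReal.ofReal (M.HWW G p p') = ENNReal.ofReal (M.a (Sum.inr p) p') *
      normLattice (M.h (Sum.inr p) (Sum.inr p')) (G.n p') := by
  have : M.HWW G p p' = M.a (Sum.inr p) p' * (M.hNorm G (Sum.inr p) (Sum.inr p')).toReal := by
    change (lip (M.Φ (Sum.inr p)) : ℝ) * M.a (Sum.inr p) p' * _ = _
    rw [hM.lip_link_chain, one_mul]
  rw [this, ENNReal.ofReal_mul (M.a_nonneg _ _), ENNReal.ofReal_toReal h, hNorm]

end Params

theorem tsum_subtype_eq_tsum_ite {α : Type*} (p : α → Prop) [DecidablePred p] (f : α → ℝ≥0∞) :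
    ∑' x : {x // p x}, f x = ∑' x, if p x then f x else 0 := by
  refine (tsum_subtype {x | p x} f).trans (tsum_congr fun x => ?_)
  simp [Set.indicator_apply]

/-! ### The autoregression kernel of the chains -/

/-- Induction along the grid: only finitely many grid times lie between `t₁` and a given one. -/
theorem Grid.induction {P : Type*} [Finite P] (G : Grid P) (t₁ : ℝ) {motive : P × ℤ → Prop}
    (h : ∀ q, (∀ r, t₁ ≤ G.time r → G.time r < G.time q → motive r) → motive q) (q : P × ℤ) :
    motive q := by
  generalize hn : (G.finite_Ico t₁ (G.time q)).toFinset.card = n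
  induction n using Nat.strong_induction_on generalizing q with
  | _ n ih =>
    refine h q fun r h1 h2 => ih _ ?_ r rfl
    rw [← hn]
    refine Finset.card_lt_card ((Finset.ssubset_iff_of_subset fun x hx => ?_).2 ⟨r, ?_, ?_⟩)
    · rw [Set.Finite.mem_toFinset] at hx ⊢
      exact ⟨hx.1, hx.2.trans h2⟩
    · rw [Set.Finite.mem_toFinset]; exact ⟨h1, h2⟩
    · rw [Set.Finite.mem_toFinset]; exact fun hr => lt_irrefl _ hr.2

section Kernel

variable {N P : Type*}

open Classical in
/-- The weight with which the chain value at `r` enters the one at `q`. -/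
noncomputable def kernel (G : Grid P) (M : Params N P) (q r : P × ℤ) : ℝ≥0∞ :=
  if G.time r < G.time q then
    ENNReal.ofReal (M.a (Sum.inr q.1) r.1 *
      M.h (Sum.inr q.1) (Sum.inr r.1) (G.time q - G.time r))
  else 0

/-- The operator with kernel `kernel`. -/
noncomputable def kernelOp (G : Grid P) (M : Params N P) (v : P × ℤ → ℝ≥0∞) (q : P × ℤ) : ℝ≥0∞ :=
  ∑' r, kernel G M q r * v r

variable {G : Grid P} {M : Params N P}

theorem kernel_of_not_lt {q r : P × ℤ} (h : ¬ G.time r < G.time q) : kernel G M q r = 0 :=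
  if_neg h

theorem kernelOp_mono {v w : P × ℤ → ℝ≥0∞} (h : v ≤ w) : kernelOp G M v ≤ kernelOp G M w :=
  fun _ => ENNReal.tsum_le_tsum fun r => mul_le_mul_right (h r) _

theorem kernelOp_add (v w : P × ℤ → ℝ≥0∞) :
    kernelOp G M (v + w) = kernelOp G M v + kernelOp G M w := by
  funext q
  simp only [kernelOp, Pi.add_apply, mul_add, ENNReal.tsum_add]

/-- Applied with `w = |W|`: a subinvariant function below the chains is below all the iterates,
whose expectations tend to `0` under the spectral condition. -/
theorem le_iterate_kernelOp {d w : P × ℤ → ℝ≥0∞} (h : d ≤ kernelOp G M d) (hw : d ≤ w) (n : ℕ) :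
    d ≤ (kernelOp G M)^[n] w := by
  induction n with
  | zero => exact hw
  | succ n ih =>
    rw [Function.iterate_succ_apply']
    exact h.trans (kernelOp_mono ih)

/-- A subinvariant function that vanishes before some time vanishes. -/
theorem eq_zero_of_le_kernelOp [Finite P] {d : P × ℤ → ℝ≥0∞} (h : d ≤ kernelOp G M d) (t₁ : ℝ)
    (h0 : ∀ q, G.time q < t₁ → d q = 0) (q : P × ℤ) : d q = 0 := by
  refine G.induction t₁ (motive := fun q => d q = 0) (fun q ih => ?_) q
  refine le_antisymm ((h q).trans (le_of_eq (ENNReal.tsum_eq_zero.2 fun r => ?_))) zero_le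
  by_cases h1 : G.time r < G.time q
  · rcases lt_or_ge (G.time r) t₁ with h2 | h2
    · rw [h0 r h2, mul_zero]
    · rw [ih r h2 h1, mul_zero]
  · rw [kernel_of_not_lt h1, zero_mul]

/-! ### The recursion coefficients as fundamental solution -/

section Coef

variable [Fintype P]

theorem coef_self (q : P × ℤ) : coef G M q q = 1 := by
  rw [coef]; simp

theorem coef_of_not_lt {q q' : P × ℤ} (hne : q ≠ q') (h : ¬ G.time q' < G.time q) :
    coef G M q q' = 0 := by
  rw [coef, if_neg hne, if_neg h]

theorem coef_of_time_lt {q q' : P × ℤ} (h : G.time q < G.time q') : coef G M q q' = 0 :=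
  coef_of_not_lt (by rintro rfl; exact lt_irrefl _ h) h.not_gt

theorem coef_of_lt {q q' : P × ℤ} (h : G.time q' < G.time q) :
    coef G M q q' = ∑ r ∈ (G.finite_Ico (G.time q') (G.time q)).toFinset,
      M.a (Sum.inr q.1) r.1 * M.h (Sum.inr q.1) (Sum.inr r.1) (G.time q - G.time r) *
        coef G M r q' := by
  rw [coef, if_neg (by rintro rfl; exact lt_irrefl _ h), if_pos h]
  exact Finset.sum_attach _ fun r : P × ℤ =>
    M.a (Sum.inr q.1) r.1 * M.h (Sum.inr q.1) (Sum.inr r.1) (G.time q - G.time r) * coef G M r q'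

theorem coef_nonneg (hM : M.IsLinear) (q q' : P × ℤ) : 0 ≤ coef G M q q' := by
  refine G.induction (G.time q') (motive := fun q => 0 ≤ coef G M q q') (fun q ih => ?_) q
  by_cases hne : q = q'
  · rw [hne, coef_self]; exact zero_le_one
  by_cases h : G.time q' < G.time q
  · rw [coef_of_lt h]
    refine Finset.sum_nonneg fun r hr => ?_
    have hr' := (Set.Finite.mem_toFinset _).1 hr
    exact mul_nonneg (mul_nonneg (M.a_nonneg _ _) (hM.h_nonneg _ _ _ (sub_pos.2 hr'.2)))
      (ih r hr'.1 hr'.2)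
  · rw [coef_of_not_lt hne h]

open Classical in
/-- The recursion that defines `coef`, as a fixed point equation for `kernelOp`. -/
theorem ofReal_coef_eq (hM : M.IsLinear) (q q' : P × ℤ) :
    ENNReal.ofReal (coef G M q q') =
      (if q = q' then 1 else 0) + kernelOp G M (fun r => ENNReal.ofReal (coef G M r q')) q := by
  -- The kernel only reaches times strictly before `q`, hence strictly before `q'`, where the
  -- coefficient is `0` by convention.
  have hz : ¬ G.time q' < G.time q →
      kernelOp G M (fun r => ENNReal.ofReal (coef G M r q')) q = 0 := by
    intro h
    refine ENNReal.tsum_eq_zero.2 fun r => ?_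
    beta_reduce
    by_cases h1 : G.time r < G.time q
    · rw [coef_of_time_lt (h1.trans_le (not_lt.1 h)), ENNReal.ofReal_zero, mul_zero]
    · rw [kernel_of_not_lt h1, zero_mul]
  by_cases hne : q = q'
  · subst hne
    rw [hz (lt_irrefl _), coef_self, if_pos rfl]; simp
  by_cases h : G.time q' < G.time q
  · rw [coef_of_lt h, if_neg hne, zero_add, kernelOp,
      tsum_eq_sum (s := (G.finite_Ico (G.time q') (G.time q)).toFinset), ENNReal.ofReal_sum_of_nonneg]
    · refine Finset.sum_congr rfl fun r hr => ?_
      have hr' := (Set.Finite.mem_toFinset _).1 hr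
      rw [kernel, if_pos hr'.2, ENNReal.ofReal_mul (mul_nonneg (M.a_nonneg _ _)
        (hM.h_nonneg _ _ _ (sub_pos.2 hr'.2)))]
    · intro r hr
      have hr' := (Set.Finite.mem_toFinset _).1 hr
      exact mul_nonneg (mul_nonneg (M.a_nonneg _ _) (hM.h_nonneg _ _ _ (sub_pos.2 hr'.2)))
        (coef_nonneg hM _ _)
    · intro r hr
      rw [Set.Finite.mem_toFinset] at hr
      by_cases h1 : G.time r < G.time q
      · rw [coef_of_time_lt (not_le.1 fun h2 => hr ⟨h2, h1⟩), ENNReal.ofReal_zero, mul_zero]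
      · rw [kernel_of_not_lt h1, zero_mul]
  · rw [hz h, if_neg hne, coef_of_not_lt hne h]; simp

/-- The operator whose kernel is given by the recursion coefficients. -/
noncomputable def green (G : Grid P) (M : Params N P) (g : P × ℤ → ℝ≥0∞) (q : P × ℤ) : ℝ≥0∞ :=
  ∑' q', ENNReal.ofReal (coef G M q q') * g q'

/-- Weighting the recursion for the coefficients by `g q'` and summing over `q'`, with an exchange
of sums, shows that `green G M g` solves `w = g + K w`. -/
theorem green_eq (hM : M.IsLinear) (g : P × ℤ → ℝ≥0∞) :
    green G M g = g + kernelOp G M (green G M g) := by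
  classical
  funext q
  rw [green, Pi.add_apply]
  simp_rw [ofReal_coef_eq hM q, add_mul, ENNReal.tsum_add]
  congr 1
  · rw [tsum_eq_single q]
    · simp
    · intro q' h; rw [if_neg h.symm, zero_mul]
  · simp_rw [kernelOp, green, ← ENNReal.tsum_mul_right, ← ENNReal.tsum_mul_left, mul_assoc]
    exact ENNReal.tsum_comm

/-- Comparison principle: `green g` is below every supersolution. -/
theorem green_le (hM : M.IsLinear) {g w : P × ℤ → ℝ≥0∞} (h : g + kernelOp G M w ≤ w) :
    green G M g ≤ w := by
  classical
  intro q
  -- Restricting to finitely many sources provides an earliest time `t₁`, from which induction along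
  -- the grid can start even though the grid extends to `-∞`.
  rw [green, ENNReal.tsum_eq_iSup_sum]
  refine iSup_le fun F => ?_
  obtain ⟨t₁, ht₁⟩ : ∃ t₁, ∀ q' ∈ F, t₁ ≤ G.time q' := by
    obtain ⟨t₁, ht⟩ := (F.image G.time).bddBelow
    exact ⟨t₁, fun q' hq' => ht (by exact_mod_cast Finset.mem_image_of_mem _ hq')⟩
  refine G.induction t₁
    (motive := fun q => ∑ q' ∈ F, ENNReal.ofReal (coef G M q q') * g q' ≤ w q) (fun q ih => ?_) q
  refine le_trans ?_ (h q)
  simp_rw [ofReal_coef_eq hM q, add_mul, Finset.sum_add_distrib]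
  refine add_le_add ?_ ?_
  · simp only [ite_mul, one_mul, zero_mul, Finset.sum_ite_eq]
    split_ifs <;> simp
  · simp_rw [kernelOp, ← ENNReal.tsum_mul_right]
    rw [← Summable.tsum_finsetSum fun _ _ => ENNReal.summable]
    refine ENNReal.tsum_le_tsum fun r => ?_
    simp_rw [mul_assoc]
    rw [← Finset.mul_sum]
    by_cases h1 : G.time r < G.time q
    · refine mul_le_mul_right ?_ _
      by_cases h2 : t₁ ≤ G.time r
      · exact ih r h2 h1
      · rw [Finset.sum_eq_zero]
        · exact zero_le
        · intro q' hq'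
          rw [coef_of_time_lt ((not_le.1 h2).trans_le (ht₁ q' hq')), ENNReal.ofReal_zero, zero_mul]
    · rw [kernel_of_not_lt h1, zero_mul]; exact zero_le

/-- A finite solution of `w = g + kernelOp w` is `green g` if there is no nonzero subinvariant
function below it. -/
theorem eq_green (hM : M.IsLinear) {g w : P × ℤ → ℝ≥0∞} (h : w = g + kernelOp G M w)
    (hu : ∀ d : P × ℤ → ℝ≥0∞, d ≤ kernelOp G M d → d ≤ w → ∀ q, d q = 0) :
    w = green G M g := by
  have hle : green G M g ≤ w := green_le hM h.symm.le
  refine le_antisymm (fun q => ?_) hle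
  -- The excess, by truncated subtraction, is subinvariant: `w = g + K w ≤ g + K (green g) + K (w -
  -- green g) = green g + K (w - green g)`.
  refine tsub_eq_zero_iff_le.1 (hu (w - green G M g) ?_ tsub_le_self q)
  rw [tsub_le_iff_left]
  calc w = g + kernelOp G M w := h
    _ ≤ g + kernelOp G M (green G M g + (w - green G M g)) :=
        add_le_add le_rfl (kernelOp_mono le_add_tsub)
    _ = green G M g + kernelOp G M (w - green G M g) := by
        rw [kernelOp_add, ← add_assoc, ← green_eq hM]

end Coef

/-! ### Bounds under the spectral assumption -/

/-- The lags from `q` to the grid of `p'` form a translate of the lattice of mesh `1 / n_{p'}`, one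
of those over which the lattice norm takes its supremum. The index changes sign because it enters
the lag negatively. -/
theorem tsum_kernel_le_normLattice (hM : M.IsLinear) (q : P × ℤ) (p' : P) :
    ∑' j : ℤ, kernel G M q (p', j) ≤ ENNReal.ofReal (M.a (Sum.inr q.1) p') *
      normLattice (M.h (Sum.inr q.1) (Sum.inr p')) (G.n p') := by
  classical
  rw [normLattice]
  refine le_trans (le_of_eq ?_) (mul_le_mul_right (le_iSup (fun x : ℝ => ∑' k : ℤ,
    if 0 < x + (k : ℝ) / (G.n p' : ℝ) then
      ‖M.h (Sum.inr q.1) (Sum.inr p') (x + (k : ℝ) / (G.n p' : ℝ))‖ₑ else 0)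
    (G.time q - G.θ p')) _)
  rw [← ENNReal.tsum_mul_left, ← (Equiv.neg ℤ).tsum_eq]
  refine tsum_congr fun j => ?_
  have h1 : G.time q - G.time (p', -j) = G.time q - G.θ p' + (j : ℝ) / (G.n p' : ℝ) := by
    simp only [Grid.time]; push_cast; ring
  simp only [kernel, Equiv.neg_apply, ← sub_pos (a := G.time q), h1]
  split_ifs with h
  · rw [ENNReal.ofReal_mul (M.a_nonneg _ _), Real.enorm_of_nonneg (hM.h_nonneg _ _ _ h)]
  · rw [mul_zero]

theorem measurable_kernelOp_iterate [Finite P] {Ω : Type*} [MeasurableSpace Ω]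
    {w : P × ℤ → Ω → ℝ≥0∞} (hw : ∀ q, Measurable (w q)) (n : ℕ)
    (q : P × ℤ) : Measurable fun ω => (kernelOp G M)^[n] (fun r => w r ω) q := by
  induction n generalizing q with
  | zero => exact hw q
  | succ n ih =>
    simp_rw [Function.iterate_succ_apply', kernelOp]
    exact Measurable.tsum fun r => (ih r).const_mul _

variable [Fintype P] [DecidableEq P]

theorem tsum_kernel_le (hM : M.IsLinear) (h : M.Spec11 G) (q : P × ℤ) (p' : P) :
    ∑' j : ℤ, kernel G M q (p', j) ≤ ENNReal.ofReal (M.HWW G q.1 p') := by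
  rw [hM.ofReal_HWW (h.1 _ _)]
  exact tsum_kernel_le_normLattice hM q p'

/-- Reduction to finite dimension: on bounds that are constant along each chain, `kernelOp` is
dominated by the matrix `H^W_W`. -/
theorem kernelOp_le_sum (hM : M.IsLinear) (h : M.Spec11 G) {v : P × ℤ → ℝ≥0∞} {u : P → ℝ≥0∞}
    (hv : ∀ q, v q ≤ u q.1) (q : P × ℤ) :
    kernelOp G M v q ≤ ∑ p', ENNReal.ofReal (M.HWW G q.1 p') * u p' := by
  rw [kernelOp, ENNReal.tsum_prod', tsum_fintype]
  refine Finset.sum_le_sum fun p' _ => ?_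
  calc ∑' j : ℤ, kernel G M q (p', j) * v (p', j)
      ≤ ∑' j : ℤ, kernel G M q (p', j) * u p' :=
        ENNReal.tsum_le_tsum fun j => mul_le_mul_right (hv _) _
    _ ≤ _ := by rw [ENNReal.tsum_mul_right]; exact mul_le_mul_left (tsum_kernel_le hM h q p') _

/-- The sum is `green` applied to the indicator of the chain `p'`. Column `p'` of the resolvent,
made constant along each chain, is a supersolution for this source because `B = 1 + H^W_W B`, so
`green_le` applies. -/
theorem tsum_coef_le (hM : M.IsLinear) (h : M.Spec11 G) (q : P × ℤ) (p' : P) :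
    ∑' j : ℤ, ENNReal.ofReal (coef G M q (p', j)) ≤
      ENNReal.ofReal (((1 - M.HWW G)⁻¹ : Matrix P P ℝ) q.1 p') := by
  have hB := inv_one_sub_apply_nonneg (M.HWW_nonneg G) h.2
  have hg := green_le (G := G) hM (g := fun q => if q.1 = p' then 1 else 0)
    (w := fun q => ENNReal.ofReal (((1 - M.HWW G)⁻¹ : Matrix P P ℝ) q.1 p')) (fun q => by
      refine (add_le_add le_rfl (kernelOp_le_sum hM h
        (u := fun p => ENNReal.ofReal (((1 - M.HWW G)⁻¹ : Matrix P P ℝ) p p'))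
        (fun _ => le_rfl) q)).trans (le_of_eq ?_)
      beta_reduce
      conv_rhs => rw [inv_one_sub_eq_one_add_mul (M.HWW G) h.2, Matrix.add_apply, Matrix.mul_apply]
      rw [ENNReal.ofReal_add, ENNReal.ofReal_sum_of_nonneg]
      · congr 1
        · rw [Matrix.one_apply]; split_ifs <;> simp
        · exact Finset.sum_congr rfl fun p _ => (ENNReal.ofReal_mul (M.HWW_nonneg G _ _)).symm
      · exact fun p _ => mul_nonneg (M.HWW_nonneg G _ _) (hB _ _)
      · rw [Matrix.one_apply]; split_ifs <;> norm_num
      · exact Finset.sum_nonneg fun p _ => mul_nonneg (M.HWW_nonneg G _ _) (hB _ _)) q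
  refine le_trans ?_ hg
  rw [green, ENNReal.tsum_prod', tsum_fintype (L := .unconditional P)]
  refine le_trans (le_of_eq ?_) (Finset.single_le_sum (fun _ _ => zero_le) (Finset.mem_univ p'))
  simp

/-! ### Uniqueness in expectation -/

section Expectation

variable {Ω : Type*} [MeasurableSpace Ω] {Pr : Measure Ω}

/-- The operator is deterministic and nonnegative, so it commutes with the expectation; each
application costs one factor `H^W_W` by `kernelOp_le_sum`. -/
theorem lintegral_kernelOp_iterate_le (hM : M.IsLinear) (h : M.Spec11 G)
    {w : P × ℤ → Ω → ℝ≥0∞} (hw : ∀ q, Measurable (w q)) {c : ℝ≥0∞}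
    (hc : ∀ q, ∫⁻ ω, w q ω ∂Pr ≤ c) (n : ℕ) (q : P × ℤ) :
    ∫⁻ ω, (kernelOp G M)^[n] (fun r => w r ω) q ∂Pr ≤
      ∑ p', ENNReal.ofReal ((M.HWW G ^ n) q.1 p') * c := by
  induction n generalizing q with
  | zero =>
    refine (hc q).trans ?_
    refine le_trans ?_ (Finset.single_le_sum (fun _ _ => zero_le) (Finset.mem_univ q.1))
    simp
  | succ n ih =>
    simp_rw [Function.iterate_succ_apply']
    simp_rw [kernelOp]
    rw [lintegral_tsum fun r => ((measurable_kernelOp_iterate hw n r).const_mul _).aemeasurable]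
    simp_rw [lintegral_const_mul _ (measurable_kernelOp_iterate (G := G) (M := M) hw n _)]
    refine (kernelOp_le_sum hM h (u := fun p => ∑ p', ENNReal.ofReal ((M.HWW G ^ n) p p') * c)
      ih q).trans (le_of_eq ?_)
    simp_rw [Finset.mul_sum]
    rw [Finset.sum_comm]
    refine Finset.sum_congr rfl fun p' _ => ?_
    rw [pow_succ', Matrix.mul_apply, ENNReal.ofReal_sum_of_nonneg, Finset.sum_mul]
    · refine Finset.sum_congr rfl fun p _ => ?_
      rw [ENNReal.ofReal_mul (M.HWW_nonneg G _ _), mul_assoc]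
    · exact fun p _ => mul_nonneg (M.HWW_nonneg G _ _) (pow_apply_nonneg (M.HWW_nonneg G) _ _ _)

/-- Almost surely, there is no nonzero subinvariant function below a family of random variables
that is bounded in `L¹`. -/
theorem ae_eq_zero_of_le_kernelOp (hM : M.IsLinear) (h : M.Spec11 G)
    {w : P × ℤ → Ω → ℝ≥0∞} (hw : ∀ q, Measurable (w q)) {c : ℝ≥0∞} (hc' : c ≠ ∞)
    (hc : ∀ q, ∫⁻ ω, w q ω ∂Pr ≤ c) :
    ∀ᵐ ω ∂Pr, ∀ d : P × ℤ → ℝ≥0∞, d ≤ kernelOp G M d → d ≤ (fun q => w q ω) →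
      ∀ q, d q = 0 := by
  -- The infimum does not involve `d`, so the exceptional null set, a union over the countable grid,
  -- serves all `d` at once.
  have key : ∀ q, ∀ᵐ ω ∂Pr, ⨅ n, (kernelOp G M)^[n] (fun r => w r ω) q = 0 := by
    intro q
    refine (lintegral_eq_zero_iff
      (Measurable.iInf fun n => measurable_kernelOp_iterate hw n q)).1 ?_
    refine le_antisymm (ge_of_tendsto' (x := Filter.atTop) (f := fun n : ℕ =>
      ∑ p', ENNReal.ofReal ((M.HWW G ^ n) q.1 p') * c) ?_ fun n => ?_) zero_le
    · rw [show (0 : ℝ≥0∞) = ∑ p' : P, ENNReal.ofReal 0 * c by simp]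
      refine tendsto_finsetSum _ fun p' _ => ENNReal.Tendsto.mul_const ?_ (Or.inr hc')
      exact ENNReal.tendsto_ofReal (tendsto_pow_apply_of_spectralRadius_lt_one _ h.2 _ _)
    · exact (lintegral_mono fun ω => iInf_le _ n).trans
        (lintegral_kernelOp_iterate_le hM h hw hc n q)
  filter_upwards [ae_all_iff.2 key] with ω hω d hd hdw q
  refine le_antisymm ?_ zero_le
  rw [← hω q]
  exact le_iInf fun n => le_iterate_kernelOp hd hdw n q

end Expectation

end Kernel

/-! ### Pathwise representation -/

/-- The negative part is subadditive, and continuity carries this from finite sums to the limit. It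
handles the chain equation before the signs of its terms are known. -/
theorem ofReal_neg_tsum_le {ι : Type*} {y : ι → ℝ} (hy : Summable y) :
    ENNReal.ofReal (-∑' i, y i) ≤ ∑' i, ENNReal.ofReal (-y i) := by
  have h : HasSum (fun i => -y i) (-∑' i, y i) := hy.hasSum.neg
  refine le_of_tendsto' (ENNReal.tendsto_ofReal h) fun F => ?_
  refine le_trans ?_ (ENNReal.sum_le_tsum F)
  induction F using Finset.cons_induction with
  | empty => simp
  | cons i F hi ih =>
    rw [Finset.sum_cons, Finset.sum_cons]
    exact ENNReal.ofReal_add_le.trans (add_le_add le_rfl ih)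

open Classical in
theorem tsum_past (t₀ : WithBot ℝ) (t : ℝ) (S : Set ℝ) (f : ℝ → ℝ≥0∞) :
    ∑' s : past t₀ t S, f s =
      ∑' s : ℝ, if s ∈ S ∧ t₀ ≤ (s : WithBot ℝ) ∧ s < t then f s else 0 :=
  tsum_subtype_eq_tsum_ite (fun s => s ∈ S ∧ t₀ ≤ (s : WithBot ℝ) ∧ s < t) f

open Classical in
theorem Grid.tsum_past {P : Type*} (G : Grid P) (t₀ : WithBot ℝ) (t : ℝ) (f : P × ℤ → ℝ≥0∞) :
    ∑' q : G.past t₀ t, f q =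
      ∑' q : P × ℤ, if t₀ ≤ (G.time q : WithBot ℝ) ∧ G.time q < t then f q else 0 :=
  tsum_subtype_eq_tsum_ite (fun q => t₀ ≤ (G.time q : WithBot ℝ) ∧ G.time q < t) f

/-! ### Immigrant and cluster terms through the operator `green` -/

section Green

variable {N P : Type*} [Fintype P] {G : Grid P} {M : Params N P}

theorem green_add (f g : P × ℤ → ℝ≥0∞) : green G M (f + g) = green G M f + green G M g := by
  funext q
  simp only [green, Pi.add_apply, mul_add, ENNReal.tsum_add]

theorem green_sum {ι : Type*} (s : Finset ι) (f : ι → P × ℤ → ℝ≥0∞) :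
    green G M (∑ i ∈ s, f i) = ∑ i ∈ s, green G M (f i) := by
  funext q
  simp only [green, Finset.sum_apply, Finset.mul_sum]
  exact Summable.tsum_finsetSum fun _ _ => ENNReal.summable

-- The restriction `k' ≤ k` is automatic, since `coef` vanishes beyond it, and the restriction `t₀ ≤
-- k'` is absorbed into the source. Thus `Hb`, `Hxi` and `Hpt` are values of `green`.
open Classical in
theorem tsum_pastClosed_coef_mul (t₀ : WithBot ℝ) (q : P × ℤ) (f : P × ℤ → ℝ≥0∞) :
    ∑' q' : G.pastClosed t₀ (G.time q), ENNReal.ofReal (coef G M q q') * f q' =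
      green G M (fun q' => if t₀ ≤ (G.time q' : WithBot ℝ) then f q' else 0) q := by
  refine (tsum_subtype_eq_tsum_ite (fun q' => t₀ ≤ (G.time q' : WithBot ℝ) ∧
    G.time q' ≤ G.time q) fun q' => ENNReal.ofReal (coef G M q q') * f q').trans ?_
  refine tsum_congr fun q' => ?_
  by_cases h1 : t₀ ≤ (G.time q' : WithBot ℝ)
  · by_cases h2 : G.time q' ≤ G.time q
    · simp [h1, h2]
    · simp [h1, h2, coef_of_time_lt (not_le.1 h2)]
  · simp [h1]

-- After the exchange of sums, only points `s < k'` contribute to the term of `k' ≤ k`, so the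
-- window `[t₀, k)` shrinks to `[t₀, k')`: the source is the direct influence of the points on the
-- chain at `k'`.
open Classical in
theorem tsum_past_Hpt (t₀ : WithBot ℝ) (S : Set ℝ) (m : N) (q : P × ℤ) :
    ∑' s : past t₀ (G.time q) S, Hpt G M t₀ m q s =
      green G M (fun q' => if t₀ ≤ (G.time q' : WithBot ℝ) then
        ∑' s : past t₀ (G.time q') S,
          ENNReal.ofReal (M.h (Sum.inr q'.1) (Sum.inl m) (G.time q' - s)) else 0) q := by
  have hH : ∀ s, Hpt G M t₀ m q s = ∑' q', ENNReal.ofReal (coef G M q q') *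
      if t₀ ≤ (G.time q' : WithBot ℝ) then if s < G.time q' then
        ENNReal.ofReal (M.h (Sum.inr q'.1) (Sum.inl m) (G.time q' - s)) else 0 else 0 :=
    fun s => tsum_pastClosed_coef_mul t₀ q (fun q' => if s < G.time q' then
        ENNReal.ofReal (M.h (Sum.inr q'.1) (Sum.inl m) (G.time q' - s)) else 0)
  simp_rw [hH]
  rw [ENNReal.tsum_comm, green]
  refine tsum_congr fun q' => ?_
  rw [ENNReal.tsum_mul_left]
  by_cases h2 : G.time q' ≤ G.time q
  · congr 1
    split_ifs with h1
    · rw [tsum_past t₀ _ S fun s =>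
          ENNReal.ofReal (M.h (Sum.inr q'.1) (Sum.inl m) (G.time q' - s)),
        tsum_past t₀ _ S fun s => if s < G.time q' then
          ENNReal.ofReal (M.h (Sum.inr q'.1) (Sum.inl m) (G.time q' - s)) else 0]
      refine tsum_congr fun s => ?_
      rw [← ite_and]
      refine if_congr ⟨fun h => ⟨h.1.1, h.1.2.1, h.2⟩, fun h => ⟨⟨h.1, h.2.1, ?_⟩, h.2.2⟩⟩ rfl rfl
      exact h.2.2.trans_le h2
    · simp
  · rw [coef_of_time_lt (not_le.1 h2)]; simp

open Classical in
/-- The part of `𝔥^m_{m₀}(s, t)` that is mediated by the chains, in terms of `Hpt`. -/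
theorem clusterFun_eq (t₀ : WithBot ℝ) {s : ℝ} (hs : t₀ ≤ (s : WithBot ℝ)) (t : ℝ) (m m₀ : N) :
    clusterFun G M m m₀ s t = ENNReal.ofReal (M.h (Sum.inl m) (Sum.inl m₀) (t - s)) +
      ∑' q : G.past t₀ t, if s < G.time q then
        ENNReal.ofReal (M.h (Sum.inl m) (Sum.inr q.1.1) (t - G.time q)) *
          (ENNReal.ofReal (M.a (Sum.inl m) q.1.1) * Hpt G M t₀ m₀ q s) else 0 := by
  rw [clusterFun]
  congr 1
  rw [G.tsum_past t₀ t fun q => if s < G.time q then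
        ENNReal.ofReal (M.h (Sum.inl m) (Sum.inr q.1) (t - G.time q)) *
          (ENNReal.ofReal (M.a (Sum.inl m) q.1) * Hpt G M t₀ m₀ q s) else 0]
  refine (tsum_subtype_eq_tsum_ite (fun q : P × ℤ => s < G.time q ∧ G.time q < t) fun q =>
      ∑' q' : {q' : P × ℤ // s < G.time q' ∧ G.time q' ≤ G.time q},
        ENNReal.ofReal (M.a (Sum.inl m) q.1 *
          M.h (Sum.inl m) (Sum.inr q.1) (t - G.time q)) *
        ENNReal.ofReal (coef G M q q') *
        ENNReal.ofReal (M.h (Sum.inr q'.1.1) (Sum.inl m₀) (G.time q' - s))).trans ?_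
  refine tsum_congr fun q => ?_
  have hst : ∀ {u : ℝ}, s < u → t₀ ≤ (u : WithBot ℝ) := fun h =>
    hs.trans (WithBot.coe_le_coe.2 h.le)
  rw [← ite_and]
  refine ite_congr (propext ⟨fun h => ⟨⟨hst h.1, h.2⟩, h.1⟩, fun h => ⟨h.2, h.1.2⟩⟩)
    (fun h => ?_) fun _ => rfl
  simp_rw [mul_assoc]
  rw [ENNReal.tsum_mul_left, ENNReal.ofReal_mul (M.a_nonneg _ _), ← mul_assoc,
    mul_comm (ENNReal.ofReal (M.h _ _ _))]
  congr 1
  rw [Hpt]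
  refine (tsum_subtype_eq_tsum_ite (fun q' : P × ℤ => s < G.time q' ∧ G.time q' ≤ G.time q)
    fun q' => ENNReal.ofReal (coef G M q q') *
        ENNReal.ofReal (M.h (Sum.inr q'.1) (Sum.inl m₀) (G.time q' - s))).trans ?_
  refine Eq.trans ?_ (tsum_subtype_eq_tsum_ite (fun q' : P × ℤ => t₀ ≤ (G.time q' : WithBot ℝ) ∧
    G.time q' ≤ G.time q) fun q' => ENNReal.ofReal (coef G M q q') * if s < G.time q' then
        ENNReal.ofReal (M.h (Sum.inr q'.1) (Sum.inl m₀) (G.time q' - s)) else 0).symm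
  refine tsum_congr fun q' => ?_
  rw [mul_ite, mul_zero, ← ite_and]
  exact if_congr ⟨fun h => ⟨⟨hst h.1, h.2⟩, h.1⟩, fun h => ⟨h.2, h.1.2⟩⟩ rfl rfl

/-- Summation of the cluster functions over the points of one node. -/
theorem tsum_past_clusterFun (t₀ : WithBot ℝ) (S : Set ℝ) (t : ℝ) (m m₀ : N) :
    ∑' s : past t₀ t S, clusterFun G M m m₀ s t =
      ∑' s : past t₀ t S, ENNReal.ofReal (M.h (Sum.inl m) (Sum.inl m₀) (t - s)) +
      ∑' q : G.past t₀ t, ENNReal.ofReal (M.h (Sum.inl m) (Sum.inr q.1.1) (t - G.time q)) *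
          (ENNReal.ofReal (M.a (Sum.inl m) q.1.1) *
            ∑' s : past t₀ (G.time q) S, Hpt G M t₀ m₀ q s) := by
  classical
  rw [tsum_congr fun s : past t₀ t S => clusterFun_eq (G := G) (M := M) t₀ s.2.2.1 t m m₀,
    ENNReal.tsum_add, ENNReal.tsum_comm]
  congr 1
  refine tsum_congr fun q => ?_
  rw [← ENNReal.tsum_mul_left, ← ENNReal.tsum_mul_left,
    tsum_past t₀ t S fun s => if s < G.time q then
        ENNReal.ofReal (M.h (Sum.inl m) (Sum.inr q.1.1) (t - G.time q)) *
          (ENNReal.ofReal (M.a (Sum.inl m) q.1.1) * Hpt G M t₀ m₀ q s) else 0,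
    tsum_past t₀ (G.time q) S fun s =>
        ENNReal.ofReal (M.h (Sum.inl m) (Sum.inr q.1.1) (t - G.time q)) *
          (ENNReal.ofReal (M.a (Sum.inl m) q.1.1) * Hpt G M t₀ m₀ q s)]
  refine tsum_congr fun s => ?_
  rw [← ite_and]
  refine if_congr ⟨fun h => ⟨h.1.1, h.1.2.1, h.2⟩, fun h => ⟨⟨h.1, h.2.1, ?_⟩, h.2.2⟩⟩ rfl rfl
  exact h.2.2.trans q.2.2

end Green

/-! ### Chains and intensities for a fixed realization -/

section Path

variable {Ω N P : Type*} [Fintype N] {G : Grid P} {M : Params N P} {X : Triple Ω N P}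
  {t₀ : WithBot ℝ} {ω : Ω}

theorem Triple.input_nonneg (hM : M.IsLinear) (hW : ∀ q, t₀ ≤ (G.time q : WithBot ℝ) → 0 ≤ X.W q ω)
    (α : N ⊕ P) (t : ℝ) : 0 ≤ X.input G M t₀ α t ω := by
  refine add_nonneg (Finset.sum_nonneg fun m _ => tsum_nonneg fun s => ?_) (tsum_nonneg fun q => ?_)
  · exact hM.h_nonneg _ _ _ (sub_pos.2 s.2.2.2)
  · rw [hM.mask_eq]
    exact mul_nonneg (hM.h_nonneg _ _ _ (sub_pos.2 q.2.2))
      (add_nonneg (mul_nonneg (M.a_nonneg _ _) (hW _ q.2.1)) (hM.b_nonneg _ _))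

theorem Triple.ofReal_input (hM : M.IsLinear)
    (hW : ∀ q, t₀ ≤ (G.time q : WithBot ℝ) → 0 ≤ X.W q ω) {α : N ⊕ P} {t : ℝ}
    (hc : X.InputConverges G M t₀ α t ω) :
    ENNReal.ofReal (X.input G M t₀ α t ω) =
      ∑ m, ∑' s : past t₀ t (X.S m ω), ENNReal.ofReal (M.h α (Sum.inl m) (t - s)) +
      ∑' q : G.past t₀ t, ENNReal.ofReal (M.h α (Sum.inr q.1.1) (t - G.time q)) *
        (ENNReal.ofReal (M.a α q.1.1) * ENNReal.ofReal (X.W q ω) +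
          ENNReal.ofReal (M.b α q.1.1)) := by
  have h1 : ∀ m, ∀ s : past t₀ t (X.S m ω), 0 ≤ M.h α (Sum.inl m) (t - s) :=
    fun m s => hM.h_nonneg _ _ _ (sub_pos.2 s.2.2.2)
  have h2 : ∀ q : G.past t₀ t, 0 ≤ M.h α (Sum.inr q.1.1) (t - G.time q) :=
    fun q => hM.h_nonneg _ _ _ (sub_pos.2 q.2.2)
  have h3 : ∀ q : G.past t₀ t, 0 ≤ M.κ α q.1.1 (X.W q ω) := fun q => by
    rw [hM.mask_eq]
    exact add_nonneg (mul_nonneg (M.a_nonneg _ _) (hW _ q.2.1)) (hM.b_nonneg _ _)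
  rw [Triple.input, ENNReal.ofReal_add
    (Finset.sum_nonneg fun m _ => tsum_nonneg (h1 m))
    (tsum_nonneg fun q => mul_nonneg (h2 q) (h3 q)),
    ENNReal.ofReal_sum_of_nonneg fun m _ => tsum_nonneg (h1 m),
    ENNReal.ofReal_tsum_of_nonneg (fun q => mul_nonneg (h2 q) (h3 q)) hc.2]
  congr 1
  · exact Finset.sum_congr rfl fun m _ => ENNReal.ofReal_tsum_of_nonneg (h1 m) (hc.1 m)
  · refine tsum_congr fun q => ?_
    rw [ENNReal.ofReal_mul (h2 q), hM.mask_eq, ENNReal.ofReal_add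
      (mul_nonneg (M.a_nonneg _ _) (hW _ q.2.1)) (hM.b_nonneg _ _),
      ENNReal.ofReal_mul (M.a_nonneg _ _)]

open Classical in
/-- There is no nonzero subinvariant function below the absolute values of the chains. -/
def Triple.NoSubinvariant (X : Triple Ω N P) (G : Grid P) (M : Params N P) (t₀ : WithBot ℝ)
    (ω : Ω) : Prop :=
  ∀ d : P × ℤ → ℝ≥0∞, d ≤ kernelOp G M d →
    (∀ q, d q ≤ if t₀ ≤ (G.time q : WithBot ℝ) then ‖X.W q ω‖ₑ else 0) → ∀ q, d q = 0

/-- The negative part of `W` is subinvariant: the drifts, the points and the `b`-terms contribute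
nonnegatively, so only negative past values can make `W` negative. It lies below `|W|`, hence
vanishes. -/
theorem Triple.NoSubinvariant.chain_nonneg (hM : M.IsLinear) {ξ : P × ℤ → Ω → ℝ}
    (hu : X.NoSubinvariant G M t₀ ω) (hξ : ∀ q, 0 ≤ ξ q ω)
    (hX : ∀ q : P × ℤ, t₀ ≤ (G.time q : WithBot ℝ) →
      X.InputConverges G M t₀ (Sum.inr q.1) (G.time q) ω ∧
      X.W q ω = ξ q ω + M.Φ (Sum.inr q.1) (X.input G M t₀ (Sum.inr q.1) (G.time q) ω))
    (q : P × ℤ) (hq : t₀ ≤ (G.time q : WithBot ℝ)) : 0 ≤ X.W q ω := by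
  classical
  have h := hu (fun q => if t₀ ≤ (G.time q : WithBot ℝ) then ENNReal.ofReal (-X.W q ω) else 0)
    (fun q => ?_) (fun q => ?_) q
  · rw [if_pos hq, ENNReal.ofReal_eq_zero] at h; linarith
  · beta_reduce
    by_cases hq : t₀ ≤ (G.time q : WithBot ℝ)
    · rw [if_pos hq]
      obtain ⟨hc, hW⟩ := hX q hq
      rw [hM.link_chain, id, Triple.input] at hW
      have h1 : 0 ≤ ∑ m, ∑' s : past t₀ (G.time q) (X.S m ω),
          M.h (Sum.inr q.1) (Sum.inl m) (G.time q - s) :=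
        Finset.sum_nonneg fun m _ => tsum_nonneg fun s =>
          hM.h_nonneg _ _ _ (sub_pos.2 s.2.2.2)
      have h2 : ENNReal.ofReal (-X.W q ω) ≤ ∑' r : G.past t₀ (G.time q), ENNReal.ofReal
          (-(M.h (Sum.inr q.1) (Sum.inr r.1.1) (G.time q - G.time r) *
            M.κ (Sum.inr q.1) r.1.1 (X.W r ω))) :=
        (ENNReal.ofReal_le_ofReal (by linarith [hξ q])).trans (ofReal_neg_tsum_le hc.2)
      refine h2.trans ?_
      have h3 : ∀ r : G.past t₀ (G.time q), ENNReal.ofReal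
          (-(M.h (Sum.inr q.1) (Sum.inr r.1.1) (G.time q - G.time r) *
            M.κ (Sum.inr q.1) r.1.1 (X.W r ω))) ≤ kernel G M q r * ENNReal.ofReal (-X.W r ω) := by
        intro r
        have hh := hM.h_nonneg (Sum.inr q.1) (Sum.inr r.1.1) _ (sub_pos.2 r.2.2)
        rw [kernel, if_pos r.2.2, ← ENNReal.ofReal_mul (mul_nonneg (M.a_nonneg _ _) hh)]
        refine ENNReal.ofReal_le_ofReal ?_
        rw [hM.mask_eq]
        -- The two sides differ by `h b ≥ 0`.
        nlinarith [mul_nonneg hh (hM.b_nonneg (Sum.inr q.1) r.1.1)]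
      refine (ENNReal.tsum_le_tsum h3).trans ?_
      rw [G.tsum_past t₀ (G.time q) fun r => kernel G M q r * ENNReal.ofReal (-X.W r ω), kernelOp]
      refine ENNReal.tsum_le_tsum fun r => ?_
      split_ifs with h4 h5 h5
      · exact le_rfl
      · exact absurd h4.1 h5
      · exact zero_le
      · exact zero_le
    · rw [if_neg hq]; exact zero_le
  · split_ifs
    · rw [← ofReal_norm]
      exact ENNReal.ofReal_le_ofReal (neg_le_abs _)
    · exact le_rfl

variable [Fintype P]

/-- The positivity of `W` turns the chain equation into `w = g + K w` in `[0, ∞]`; `eq_green`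
identifies `w` with `green g`, and additivity of `green` separates the three kinds of source. -/
theorem Triple.NoSubinvariant.ofReal_chain_eq (hM : M.IsLinear) {ξ : P × ℤ → Ω → ℝ}
    (hu : X.NoSubinvariant G M t₀ ω) (hξ : ∀ q, 0 ≤ ξ q ω)
    (hX : ∀ q : P × ℤ, t₀ ≤ (G.time q : WithBot ℝ) →
      X.InputConverges G M t₀ (Sum.inr q.1) (G.time q) ω ∧
      X.W q ω = ξ q ω + M.Φ (Sum.inr q.1) (X.input G M t₀ (Sum.inr q.1) (G.time q) ω))
    (q : P × ℤ) (hq : t₀ ≤ (G.time q : WithBot ℝ)) :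
    ENNReal.ofReal (X.W q ω) = Hb G M t₀ q + Hxi G M t₀ (fun r => ξ r ω) q +
      ∑ m, ∑' t : past t₀ (G.time q) (X.S m ω), Hpt G M t₀ m q t := by
  classical
  have hW0 := hu.chain_nonneg hM hξ hX
  -- Extension by `0` before `t₀` makes the equation hold on the whole grid, as `eq_green` requires:
  -- the kernel looks only backwards, so both sides vanish before `t₀`.
  let onGrid (f : P × ℤ → ℝ≥0∞) (q : P × ℤ) : ℝ≥0∞ :=
    if t₀ ≤ (G.time q : WithBot ℝ) then f q else 0
  let fb : P × ℤ → ℝ≥0∞ := fun q' => ∑' r : G.past t₀ (G.time q'),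
    ENNReal.ofReal (M.b (Sum.inr q'.1) r.1.1 *
      M.h (Sum.inr q'.1) (Sum.inr r.1.1) (G.time q' - G.time r))
  let fS : N → P × ℤ → ℝ≥0∞ := fun m q' => ∑' s : past t₀ (G.time q') (X.S m ω),
    ENNReal.ofReal (M.h (Sum.inr q'.1) (Sum.inl m) (G.time q' - s))
  have hg : onGrid (fun q => ENNReal.ofReal (X.W q ω)) =
      green G M (onGrid fb + onGrid (fun r => ENNReal.ofReal (ξ r ω)) + ∑ m, onGrid (fS m)) := by
    refine eq_green hM (funext fun q => ?_) fun d hd hdw => hu d hd fun q => ?_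
    · by_cases hq : t₀ ≤ (G.time q : WithBot ℝ)
      · obtain ⟨hc, hW⟩ := hX q hq
        rw [hM.link_chain, id] at hW
        have hK : ∑' r : G.past t₀ (G.time q),
            ENNReal.ofReal (M.h (Sum.inr q.1) (Sum.inr r.1.1) (G.time q - G.time r)) *
              (ENNReal.ofReal (M.a (Sum.inr q.1) r.1.1) * ENNReal.ofReal (X.W r ω) +
                ENNReal.ofReal (M.b (Sum.inr q.1) r.1.1)) =
            kernelOp G M (onGrid (fun q => ENNReal.ofReal (X.W q ω))) q + fb q := by
          simp_rw [mul_add, ENNReal.tsum_add]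
          congr 1
          · rw [G.tsum_past t₀ (G.time q) fun r =>
              ENNReal.ofReal (M.h (Sum.inr q.1) (Sum.inr r.1) (G.time q - G.time r)) *
              (ENNReal.ofReal (M.a (Sum.inr q.1) r.1) * ENNReal.ofReal (X.W r ω)), kernelOp]
            refine tsum_congr fun r => ?_
            by_cases h1 : t₀ ≤ (G.time r : WithBot ℝ)
            · by_cases h2 : G.time r < G.time q
              · rw [if_pos ⟨h1, h2⟩, kernel, if_pos h2, ENNReal.ofReal_mul (M.a_nonneg _ _)]
                simp only [onGrid, if_pos h1]
                ring
              · rw [if_neg fun h => h2 h.2, kernel_of_not_lt h2, zero_mul]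
            · rw [if_neg fun h => h1 h.1]
              simp only [onGrid, if_neg h1, mul_zero]
          · refine tsum_congr fun r => ?_
            rw [ENNReal.ofReal_mul (hM.b_nonneg _ _), mul_comm]
        simp only [Pi.add_apply, Finset.sum_apply]
        simp only [onGrid, if_pos hq]
        rw [hW, ENNReal.ofReal_add (hξ q) (Triple.input_nonneg hM hW0 _ _),
          Triple.ofReal_input hM hW0 hc, hK]
        simp only [onGrid, fS]
        ring
      · simp only [Pi.add_apply, Finset.sum_apply]
        rw [kernelOp, ENNReal.tsum_eq_zero.2 fun r => ?_]
        · simp [onGrid, hq]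
        · by_cases h2 : G.time r < G.time q
          · have h1 : ¬ t₀ ≤ (G.time r : WithBot ℝ) := fun h =>
              hq (h.trans (WithBot.coe_le_coe.2 h2.le))
            simp only [onGrid, if_neg h1, mul_zero]
          · rw [kernel_of_not_lt h2, zero_mul]
    · refine (hdw q).trans ?_
      simp only [onGrid]
      split_ifs
      · exact Real.ofReal_le_enorm _
      · exact le_rfl
  have hgq := congrFun hg q
  rw [green_add, green_add, green_sum] at hgq
  simp only [Pi.add_apply, Finset.sum_apply] at hgq
  rw [show onGrid (fun q => ENNReal.ofReal (X.W q ω)) q = ENNReal.ofReal (X.W q ω) from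
    if_pos hq] at hgq
  rw [hgq]
  refine congr_arg₂ _ (congr_arg₂ _ ?_ ?_) (Finset.sum_congr rfl fun m _ => ?_)
  · exact (tsum_pastClosed_coef_mul t₀ q fb).symm
  · exact (tsum_pastClosed_coef_mul t₀ q fun r => ENNReal.ofReal (ξ r ω)).symm
  · exact (tsum_past_Hpt t₀ (X.S m ω) m q).symm

/-- The intensity of a node in terms of the cluster functions, given the representation of the
chains. -/
theorem Triple.lam_eq_of_chain (hM : M.IsLinear) {x : P × ℤ → ℝ}
    (hW : ∀ q, t₀ ≤ (G.time q : WithBot ℝ) → 0 ≤ X.W q ω ∧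
      ENNReal.ofReal (X.W q ω) = Hb G M t₀ q + Hxi G M t₀ x q +
        ∑ m, ∑' t : past t₀ (G.time q) (X.S m ω), Hpt G M t₀ m q t) {m : N} {t : ℝ}
    (hc : X.InputConverges G M t₀ (Sum.inl m) t ω)
    (hlam : X.lam m t ω = M.Φ (Sum.inl m) (M.μ m + X.input G M t₀ (Sum.inl m) t ω)) :
    0 ≤ X.lam m t ω ∧ ENNReal.ofReal (X.lam m t ω) = immigrantRate G M t₀ x m t +
      ∑ m', ∑' s : past t₀ t (X.S m' ω), clusterFun G M m m' s t := by
  have hW0 : ∀ q, t₀ ≤ (G.time q : WithBot ℝ) → 0 ≤ X.W q ω := fun q hq => (hW q hq).1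
  have hi : 0 ≤ X.input G M t₀ (Sum.inl m) t ω := Triple.input_nonneg hM hW0 _ _
  have hl : X.lam m t ω = M.μ m + X.input G M t₀ (Sum.inl m) t ω := by
    -- The argument of the link function is nonnegative, so the positive part acts as the identity.
    rcases hM.link_node m with h | h
    · rw [hlam, h, id]
    · rw [hlam, h]; exact max_eq_left (add_nonneg (hM.μ_nonneg m) hi)
  refine ⟨hl ▸ add_nonneg (hM.μ_nonneg m) hi, ?_⟩
  rw [hl, ENNReal.ofReal_add (hM.μ_nonneg m) hi, Triple.ofReal_input hM hW0 hc, immigrantRate]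
  simp_rw [tsum_past_clusterFun]
  rw [Finset.sum_add_distrib, ← Summable.tsum_finsetSum fun _ _ => ENNReal.summable]
  simp_rw [← Finset.mul_sum]
  -- The first summand belongs to the immigrant rate; the second is the chain-mediated part of the
  -- cluster functions, summed over the points.
  have h1 : ∀ q : G.past t₀ t,
      ENNReal.ofReal (M.h (Sum.inl m) (Sum.inr q.1.1) (t - G.time q)) *
        (ENNReal.ofReal (M.a (Sum.inl m) q.1.1) * ENNReal.ofReal (X.W q ω) +
          ENNReal.ofReal (M.b (Sum.inl m) q.1.1)) =
      ENNReal.ofReal (M.h (Sum.inl m) (Sum.inr q.1.1) (t - G.time q)) *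
        (ENNReal.ofReal (M.a (Sum.inl m) q.1.1) * Hb G M t₀ q +
          ENNReal.ofReal (M.a (Sum.inl m) q.1.1) * Hxi G M t₀ x q +
          ENNReal.ofReal (M.b (Sum.inl m) q.1.1)) +
      ENNReal.ofReal (M.h (Sum.inl m) (Sum.inr q.1.1) (t - G.time q)) *
        (ENNReal.ofReal (M.a (Sum.inl m) q.1.1) *
          ∑ m', ∑' s : past t₀ (G.time q) (X.S m' ω), Hpt G M t₀ m' q s) := fun q => by
    rw [(hW q q.2.1).2]; ring
  rw [tsum_congr h1, ENNReal.tsum_add]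
  ring

end Path

/-! ### Periodicity and integrals of the cluster functions -/

/-- Translation of the grid by the integer time `l`. -/
@[simps]
def Grid.shift {P : Type*} (G : Grid P) (l : ℤ) : P × ℤ ≃ P × ℤ where
  toFun q := (q.1, q.2 + l * G.n q.1)
  invFun q := (q.1, q.2 - l * G.n q.1)
  left_inv q := by simp
  right_inv q := by simp

theorem Grid.time_shift {P : Type*} (G : Grid P) (l : ℤ) (q : P × ℤ) :
    G.time (G.shift l q) = G.time q + l := by
  have hn : (G.n q.1 : ℝ) ≠ 0 := by exact_mod_cast (G.n_pos q.1).ne'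
  simp only [Grid.time, Grid.shift_apply]
  push_cast
  field_simp
  ring

section Cluster

variable {N P : Type*} [Fintype P] {G : Grid P} {M : Params N P}

/-- The recursion depends only on time differences, and an integer translation maps the grid of
every chain onto itself, whatever its frequency. -/
theorem coef_shift (l : ℤ) (q q' : P × ℤ) :
    coef G M (G.shift l q) (G.shift l q') = coef G M q q' := by
  refine G.induction (G.time q')
    (motive := fun q => coef G M (G.shift l q) (G.shift l q') = coef G M q q') (fun q ih => ?_) q
  by_cases hne : q = q'
  · rw [hne, coef_self, coef_self]
  have hiff : ∀ r r' : P × ℤ, G.time (G.shift l r) < G.time (G.shift l r') ↔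
      G.time r < G.time r' := fun r r' => by rw [G.time_shift, G.time_shift, add_lt_add_iff_right]
  by_cases h : G.time q' < G.time q
  · rw [coef_of_lt h, coef_of_lt ((hiff _ _).2 h)]
    refine (Finset.sum_equiv (G.shift l) (fun r => ?_) fun r hr => ?_).symm
    · rw [Set.Finite.mem_toFinset, Set.Finite.mem_toFinset, Set.mem_ofPred_eq, Set.mem_ofPred_eq,
        hiff, ← not_lt, ← not_lt, hiff]
    · have hr' := (Set.Finite.mem_toFinset _).1 hr
      rw [ih r hr'.1 hr'.2, G.time_shift, G.time_shift, add_sub_add_right_eq_sub]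
      rfl
  · rw [coef_of_not_lt hne h,
      coef_of_not_lt (fun h' => hne ((G.shift l).injective h')) fun h' => h ((hiff _ _).1 h')]

-- Index sets that do not depend on `s` and `t` allow reindexing by a translation and integration
-- term by term.
open Classical in
theorem clusterFun_eq_tsum_ite (m m₀ : N) (s t : ℝ) :
    clusterFun G M m m₀ s t = ENNReal.ofReal (M.h (Sum.inl m) (Sum.inl m₀) (t - s)) +
      ∑' q : P × ℤ, if s < G.time q ∧ G.time q < t then
        ∑' q' : P × ℤ, if s < G.time q' ∧ G.time q' ≤ G.time q then
          ENNReal.ofReal (M.a (Sum.inl m) q.1 *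
            M.h (Sum.inl m) (Sum.inr q.1) (t - G.time q)) *
          ENNReal.ofReal (coef G M q q') *
          ENNReal.ofReal (M.h (Sum.inr q'.1) (Sum.inl m₀) (G.time q' - s)) else 0 else 0 := by
  rw [clusterFun]
  congr 1
  refine (tsum_subtype_eq_tsum_ite (fun q : P × ℤ => s < G.time q ∧ G.time q < t) fun q =>
      ∑' q' : {q' : P × ℤ // s < G.time q' ∧ G.time q' ≤ G.time q},
        ENNReal.ofReal (M.a (Sum.inl m) q.1 *
          M.h (Sum.inl m) (Sum.inr q.1) (t - G.time q)) *
        ENNReal.ofReal (coef G M q q') *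
        ENNReal.ofReal (M.h (Sum.inr q'.1.1) (Sum.inl m₀) (G.time q' - s))).trans ?_
  refine tsum_congr fun q => if_congr Iff.rfl ?_ rfl
  exact tsum_subtype_eq_tsum_ite (fun q' : P × ℤ => s < G.time q' ∧ G.time q' ≤ G.time q) fun q' =>
    ENNReal.ofReal (M.a (Sum.inl m) q.1 * M.h (Sum.inl m) (Sum.inr q.1) (t - G.time q)) *
      ENNReal.ofReal (coef G M q q') *
      ENNReal.ofReal (M.h (Sum.inr q'.1) (Sum.inl m₀) (G.time q' - s))

/-- The cluster functions are 1-periodic. -/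
theorem clusterFun_add_one (m m₀ : N) (s t : ℝ) :
    clusterFun G M m m₀ (s + 1) (t + 1) = clusterFun G M m m₀ s t := by
  classical
  have htime : ∀ q, G.time (G.shift 1 q) = G.time q + 1 := fun q => by
    rw [G.time_shift]; norm_num
  have hfst : ∀ q, (G.shift 1 q).1 = q.1 := fun q => rfl
  rw [clusterFun_eq_tsum_ite, clusterFun_eq_tsum_ite, add_sub_add_right_eq_sub]
  congr 1
  rw [← (G.shift 1).tsum_eq]
  refine tsum_congr fun q => ?_
  rw [← (G.shift 1).tsum_eq (fun q' : P × ℤ =>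
    if s + 1 < G.time q' ∧ G.time q' ≤ G.time (G.shift 1 q) then _ else _)]
  simp only [htime, hfst, coef_shift, add_lt_add_iff_right, add_le_add_iff_right,
    add_sub_add_right_eq_sub]

/-! ### The integral bound -/

section Integral

theorem lintegral_ite_lt_eq {f : ℝ → ℝ} (u : ℝ) (hf : ∀ x, 0 < x → 0 ≤ f x) :
    ∫⁻ t : ℝ, (if u < t then ENNReal.ofReal (f (t - u)) else 0) = normL1 f := by
  rw [normL1, ← lintegral_indicator measurableSet_Ioi,
    ← lintegral_sub_right_eq_self (Set.indicator _ _) u]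
  refine lintegral_congr fun t => ?_
  by_cases h : u < t
  · rw [if_pos h, Set.indicator_of_mem (Set.mem_Ioi.2 (sub_pos.2 h)),
      Real.enorm_of_nonneg (hf _ (sub_pos.2 h))]
  · rw [if_neg h, Set.indicator_of_notMem (s := Ioi 0) fun h' => h (sub_pos.1 h')]

variable [DecidableEq P]

open Classical in
/-- The total weight of the chains of type `p` descending from a point at `s` through the chain
`p'`: a period of `p` is a block of `n_p` grid points, and by periodicity the sum over the periods
can be moved to the interaction function. -/
theorem tsum_tsum_coef_mul_le (hM : M.IsLinear) (h : M.Spec11 G) (m₀ : N) (s : ℝ) (p p' : P) :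
    ∑' j : ℤ, ∑' j' : ℤ, ENNReal.ofReal (coef G M (p, j) (p', j')) *
      (if s < G.time (p', j') then
        ENNReal.ofReal (M.h (Sum.inr p') (Sum.inl m₀) (G.time (p', j') - s)) else 0) ≤
    (G.n p : ℝ≥0∞) * (ENNReal.ofReal (((1 - M.HWW G)⁻¹ : Matrix P P ℝ) p p') *
      normLattice (M.h (Sum.inr p') (Sum.inl m₀)) 1) := by
  have : NeZero (G.n p) := ⟨(G.n_pos p).ne'⟩
  -- Write `j = i + l n_p`. Translating the source index by `l` as well removes `l` from the
  -- coefficient and leaves it only as an integer translation in the argument of `h`.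
  have hshift : ∀ (l : ℤ) (i : Fin (G.n p)),
      ∑' j' : ℤ, ENNReal.ofReal (coef G M (p, (Int.divModEquiv (G.n p)).symm (l, i)) (p', j')) *
        (if s < G.time (p', j') then
          ENNReal.ofReal (M.h (Sum.inr p') (Sum.inl m₀) (G.time (p', j') - s)) else 0) =
      ∑' j' : ℤ, ENNReal.ofReal (coef G M (p, (i : ℤ)) (p', j')) *
        (if 0 < G.time (p', j') - s + (l : ℝ) / ((1 : ℕ) : ℝ) then
          ‖M.h (Sum.inr p') (Sum.inl m₀) (G.time (p', j') - s + (l : ℝ) / ((1 : ℕ) : ℝ))‖ₑ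
          else 0) := by
    intro l i
    rw [← (Equiv.addRight (l * (G.n p' : ℤ))).tsum_eq]
    refine tsum_congr fun j' => ?_
    have h1 : (p', Equiv.addRight (l * (G.n p' : ℤ)) j') = G.shift l (p', j') := rfl
    have h2 : (p, (Int.divModEquiv (G.n p)).symm (l, i)) = G.shift l (p, (i : ℤ)) := by
      simp [Int.divModEquiv, Grid.shift, add_comm]
    rw [h1, h2, coef_shift, G.time_shift]
    congr 1
    have h3 : G.time (p', j') - s + (l : ℝ) / ((1 : ℕ) : ℝ) = G.time (p', j') + l - s := by
      rw [Nat.cast_one, div_one]; ring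
    rw [h3]
    refine ite_congr (propext sub_pos.symm) (fun hpos => ?_) fun _ => rfl
    rw [Real.enorm_of_nonneg (hM.h_nonneg _ _ _ hpos)]
  rw [← (Int.divModEquiv (G.n p)).symm.tsum_eq, ENNReal.tsum_prod', ENNReal.tsum_comm, tsum_fintype]
  simp_rw [hshift]
  refine (Finset.sum_le_card_nsmul _ _ (ENNReal.ofReal (((1 - M.HWW G)⁻¹ : Matrix P P ℝ) p p') *
      normLattice (M.h (Sum.inr p') (Sum.inl m₀)) 1) fun i _ => ?_).trans (le_of_eq ?_)
  -- For fixed `i`, the sum over `l` is bounded by the lattice norm of mesh `1` uniformly in `j'`;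
  -- the remaining sum over `j'` is a row sum of coefficients.
  · rw [ENNReal.tsum_comm]
    simp_rw [ENNReal.tsum_mul_left]
    calc _ ≤ ∑' j' : ℤ, ENNReal.ofReal (coef G M (p, (i : ℤ)) (p', j')) *
          normLattice (M.h (Sum.inr p') (Sum.inl m₀)) 1 := by
          refine ENNReal.tsum_le_tsum fun j' => mul_le_mul_right ?_ _
          rw [normLattice]
          exact le_iSup (fun x : ℝ => ∑' k : ℤ, if 0 < x + (k : ℝ) / ((1 : ℕ) : ℝ) then
            ‖M.h (Sum.inr p') (Sum.inl m₀) (x + (k : ℝ) / ((1 : ℕ) : ℝ))‖ₑ else 0)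
            (G.time (p', j') - s)
      _ ≤ _ := by
          rw [ENNReal.tsum_mul_right]
          exact mul_le_mul_left (tsum_coef_le hM h (p, (i : ℤ)) p') _
  · rw [Finset.card_univ, Fintype.card_fin, nsmul_eq_mul]

/-- Integration in `t` only sees the last factor `h^m_p (t - k)` and gives its norm, independently
of `k`. What remains is a sum of coefficients, bounded by `tsum_tsum_coef_mul_le`. -/
theorem lintegral_clusterFun_le (hM : M.IsLinear) (h : M.Spec11 G) (m m₀ : N) (s : ℝ) :
    ∫⁻ t in Ioi s, clusterFun G M m m₀ s t ≤
      normL1 (M.h (Sum.inl m) (Sum.inl m₀)) +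
        ∑ p, ∑ p', (G.n p : ℝ≥0∞) * ENNReal.ofReal (M.a (Sum.inl m) p) *
          normL1 (M.h (Sum.inl m) (Sum.inr p)) *
          ENNReal.ofReal (((1 - M.HWW G)⁻¹ : Matrix P P ℝ) p p') *
          normLattice (M.h (Sum.inr p') (Sum.inl m₀)) 1 := by
  classical
  let D : P × ℤ → P × ℤ → ℝ≥0∞ := fun q q' => ENNReal.ofReal (coef G M q q') *
    if s < G.time q' then
      ENNReal.ofReal (M.h (Sum.inr q'.1) (Sum.inl m₀) (G.time q' - s)) else 0
  let F : N ⊕ P → ℝ → ℝ → ℝ≥0∞ := fun β u t =>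
    if u < t then ENNReal.ofReal (M.h (Sum.inl m) β (t - u)) else 0
  have hF : ∀ β u, ∫⁻ t, F β u t = normL1 (M.h (Sum.inl m) β) := fun β u =>
    lintegral_ite_lt_eq u fun x => hM.h_nonneg _ _ x
  have hFm : ∀ β u, Measurable (F β u) := fun β u =>
    Measurable.ite measurableSet_Ioi
      ((M.measurable_h _ _).comp (measurable_id.sub_const u)).ennreal_ofReal measurable_const
  -- The constraints `s < k` and `k' ≤ k` are dropped, which separates the dependence on `t` (in
  -- `F`) from the sum over `q'` (in `D`).
  have hle : ∀ t ∈ Ioi s, clusterFun G M m m₀ s t ≤ F (Sum.inl m₀) s t +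
      ∑' q : P × ℤ, (ENNReal.ofReal (M.a (Sum.inl m) q.1) * ∑' q', D q q') *
        F (Sum.inr q.1) (G.time q) t := by
    intro t ht
    rw [clusterFun_eq_tsum_ite]
    refine add_le_add (le_of_eq (if_pos ht).symm) (ENNReal.tsum_le_tsum fun q => ?_)
    split_ifs with hq
    · simp only [F, if_pos hq.2]
      rw [← ENNReal.tsum_mul_left, ← ENNReal.tsum_mul_right]
      refine ENNReal.tsum_le_tsum fun q' => ?_
      split_ifs with hq'
      · simp only [D, if_pos hq'.1]
        rw [ENNReal.ofReal_mul (M.a_nonneg _ _)]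
        exact le_of_eq (by ring)
      · exact zero_le
    · exact zero_le
  refine (setLIntegral_mono' measurableSet_Ioi hle).trans
    ((setLIntegral_le_lintegral _ _).trans ?_)
  rw [lintegral_add_left (hFm _ _), hF,
    lintegral_tsum fun q => ((hFm _ _).const_mul _).aemeasurable]
  simp_rw [lintegral_const_mul _ (hFm _ _), hF]
  refine add_le_add le_rfl ?_
  rw [ENNReal.tsum_prod', tsum_fintype (L := .unconditional P)]
  refine Finset.sum_le_sum fun p _ => ?_
  dsimp only
  rw [ENNReal.tsum_mul_right, ENNReal.tsum_mul_left]
  have hD : ∑' j : ℤ, ∑' q', D (p, j) q' ≤ ∑ p', (G.n p : ℝ≥0∞) *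
      (ENNReal.ofReal (((1 - M.HWW G)⁻¹ : Matrix P P ℝ) p p') *
        normLattice (M.h (Sum.inr p') (Sum.inl m₀)) 1) := by
    simp_rw [ENNReal.tsum_prod', tsum_fintype (L := .unconditional P)]
    rw [Summable.tsum_finsetSum fun _ _ => ENNReal.summable]
    exact Finset.sum_le_sum fun p' _ => tsum_tsum_coef_mul_le hM h m₀ s p p'
  refine (mul_le_mul_left (mul_le_mul_right hD _) _).trans (le_of_eq ?_)
  rw [Finset.mul_sum, Finset.sum_mul]
  exact Finset.sum_congr rfl fun p' _ => by ring

end Integral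

end Cluster

/-! ### Almost sure uniqueness for HAR processes -/

section RandomPaths

variable {Ω N P : Type*} [MeasurableSpace Ω] {Pr : Measure Ω} {G : Grid P}
  {π : N → Ω → Set (ℝ × ℝ)} {ξ : P × ℤ → Ω → ℝ}

theorem IsDriving.history_le (h : IsDriving Pr G π ξ) (t : ℝ) :
    history G π ξ t ≤ ‹MeasurableSpace Ω› :=
  sup_le
    (iSup_le fun m => iSup_le fun B => ((h.poisson m).measurable B.1 B.2.1).comap_le)
    (iSup_le fun q => (h.measurable_ξ q.1).comap_le)

variable [Fintype N] [Fintype P] [DecidableEq N] [DecidableEq P] {M : Params N P} {t₀ : WithBot ℝ}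
  {X : Triple Ω N P}

/-- The two regimes meet here. For `t₀ = -∞` the `L¹` bound on the chains and the spectral condition
exclude subinvariant functions almost surely; for real `t₀` vanishing before `t₀` excludes them for
every realization. -/
theorem IsHAR.ae_noSubinvariant (hX : IsHAR Pr G π ξ M t₀ X) (hd : IsDriving Pr G π ξ)
    (hM : M.IsLinear) (hbot : t₀ = ⊥ → M.Spec1 G ∧ FiMe Pr ξ ∧ X.BoundedL1 Pr) :
    ∀ᵐ ω ∂Pr, X.NoSubinvariant G M t₀ ω := by
  induction t₀ using WithBot.recBotCoe with
  | bot =>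
    obtain ⟨hS, -, -, hb⟩ := hbot rfl
    have hm : ∀ q, Measurable (X.W q) := fun q =>
      (hX.adapted_W q bot_le).mono (hd.history_le _) le_rfl
    filter_upwards [ae_eq_zero_of_le_kernelOp hM hS.spec11 (fun q => (hm q).enorm) hb.ne
      fun q => le_iSup (fun q => ∫⁻ ω, ‖X.W q ω‖ₑ ∂Pr) q] with ω hω d hd hdw
    exact hω d hd fun q => by simpa using hdw q
  | coe t₁ =>
    refine Filter.Eventually.of_forall fun ω d hd hdw =>
      eq_zero_of_le_kernelOp hd t₁ fun q hq => le_antisymm ((hdw q).trans ?_) zero_le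
    rw [if_neg (by rw [WithBot.coe_le_coe]; exact hq.not_ge)]

end RandomPaths

end HAR

/-! ### The cluster representation -/

theorem theorem4p5 {Ω N P : Type*} [MeasurableSpace Ω] [Fintype N] [Fintype P]
    [DecidableEq N] [DecidableEq P]
    (Pr : MeasureTheory.Measure Ω) [MeasureTheory.IsProbabilityMeasure Pr]
    (G : HAR.Grid P) (π : N → Ω → Set (ℝ × ℝ)) (ξ : P × ℤ → Ω → ℝ)
    (hdriving : HAR.IsDriving Pr G π ξ)
    (M : HAR.Params N P) (hM : M.IsLinear)
    (hξ : ∀ᵐ ω ∂Pr, ∀ q, 0 ≤ ξ q ω) :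
    -- the process started at `t₀ ∈ {-∞} ∪ ℝ`
    (∀ (t₀ : WithBot ℝ) (X : HAR.Triple Ω N P), HAR.IsHAR Pr G π ξ M t₀ X →
      (t₀ ≠ ⊥ → M.NoExpl ∧ X.NonExploding Pr) →
      (t₀ = ⊥ → M.Spec1 G ∧ HAR.FiMe Pr ξ ∧ X.BoundedL1 Pr) →
      -- the chains
      (∀ᵐ ω ∂Pr, ∀ q : P × ℤ, t₀ ≤ (G.time q : WithBot ℝ) →
        0 ≤ X.W q ω ∧
        ENNReal.ofReal (X.W q ω) =
          HAR.Hb G M t₀ q + HAR.Hxi G M t₀ (fun r => ξ r ω) q +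
            ∑ m, ∑' t : HAR.past t₀ (G.time q) (X.S m ω), HAR.Hpt G M t₀ m q t) ∧
      -- the intensities
      (∀ᵐ z ∂(Pr.prod (MeasureTheory.volume.restrict {t : ℝ | t₀ ≤ (t : WithBot ℝ)})), ∀ m,
        0 ≤ X.lam m z.2 z.1 ∧
        ENNReal.ofReal (X.lam m z.2 z.1) =
          HAR.immigrantRate G M t₀ (fun r => ξ r z.1) m z.2 +
            ∑ m', ∑' s : HAR.past t₀ z.2 (X.S m' z.1), HAR.clusterFun G M m m' s z.2)) ∧
    -- the cluster functions are 1-periodic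
    (∀ (m m₀ : N) (s t : ℝ), s < t →
      HAR.clusterFun G M m m₀ (s + 1) (t + 1) = HAR.clusterFun G M m m₀ s t) ∧
    -- the bound on their `L¹` norms
    (M.Spec1 G → M.Spec11 G) ∧
    (M.Spec11 G → ∀ (m m₀ : N) (s : ℝ),
      ∫⁻ t in Set.Ioi s, HAR.clusterFun G M m m₀ s t ≤
        HAR.normL1 (M.h (Sum.inl m) (Sum.inl m₀)) +
          ∑ p, ∑ p', (G.n p : ENNReal) * ENNReal.ofReal (M.a (Sum.inl m) p) *
            HAR.normL1 (M.h (Sum.inl m) (Sum.inr p)) *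
            ENNReal.ofReal (((1 - M.HWW G)⁻¹ : Matrix P P ℝ) p p') *
            HAR.normLattice (M.h (Sum.inr p') (Sum.inl m₀)) 1) := by
  refine ⟨fun t₀ X hX _ hbot => ?_, fun m m₀ s t _ => HAR.clusterFun_add_one m m₀ s t,
    fun h => h.spec11, fun h m m₀ s => HAR.lintegral_clusterFun_le hM h m m₀ s⟩
  have hW : ∀ᵐ ω ∂Pr, ∀ q : P × ℤ, t₀ ≤ (G.time q : WithBot ℝ) →
      0 ≤ X.W q ω ∧ ENNReal.ofReal (X.W q ω) =
        HAR.Hb G M t₀ q + HAR.Hxi G M t₀ (fun r => ξ r ω) q +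
          ∑ m, ∑' t : HAR.past t₀ (G.time q) (X.S m ω), HAR.Hpt G M t₀ m q t := by
    filter_upwards [hX.ae_noSubinvariant hdriving hM hbot, hξ, hX.eq_W] with ω hu hξ hω q hq
    exact ⟨hu.chain_nonneg hM hξ hω q hq, hu.ofReal_chain_eq hM hξ hω q hq⟩
  refine ⟨hW, ?_⟩
  -- The null set of realizations where the chain representation fails pulls back to a null set of
  -- pairs `(ω, t)`.
  filter_upwards [hX.eq_lam, Measure.quasiMeasurePreserving_fst.ae hW] with z hz hWz m
  exact HAR.Triple.lam_eq_of_chain hM hWz (hz m).1 (hz m).2
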